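/- Conventions. A filtered space is a Hausdorff space $X$ with closed subspaces $\emptyset\subseteq X_0\subseteq X_1\subseteq\dots\subseteq X_{n-1}\subsetneq X_n=X$. Its strata are the connected components $S$ of the sets $X_i\setminus X_{i-1}$, with $\operatorname{codim}S=n-i$; a stratum is regular if $i=n$ and singular otherwise. The stratification is locally finite if every point has a neighbourhood meeting only finitely many strata. A perversity $\overline p$ assigns to each stratum an element of $\mathbb Z\cup\{\pm\infty\}$, with value $0$ on regular strata. For $A\subseteq\Delta^\ell$, $\dim A$ is the least $d$ such that $A$ lies in a finite union of Euclidean simplexes of dimension at most $d$ ($\dim\emptyset=-\infty$). A singular simplex $\sigma\colon\Delta\to X$ is $\overline p$-allowable if $\dim\sigma^{-1}(S)\le\dim\Delta-\operatorname{codim}S+\overline p(S)$ for each singular stratum $S$; a chain is $\overline p$-allowable if it is a linear combination of $\overline p$-allowable simplexes. A simplicial system $\mathcal T$ of $X$ is a choice, for each singular simplex $\sigma\colon\Delta\to X$ and each stratum $S$, of a finite family $\mathcal T_{\sigma,S}$ of Euclidean simplexes in $\Delta$ whose union contains $\sigma^{-1}(S)$ and with $\max\{\dim T: T\in\mathcal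 T_{\sigma,S}\}=\dim\sigma^{-1}(S)$ (so $\mathcal T_{\sigma,S}=\emptyset$ if $\sigma^{-1}(S)=\emptyset$). For an interior point $u$ of $\Delta$, simplexes $T\subseteq\Delta$ and $V\subseteq\partial\Delta$, the pair $\{T,u*V\}$ is in strong general position if either $T\cap(u*V)\subseteq\partial\Delta$, or the interiors of $T$ and $u*V$ meet and $\dim(T\cap(u*V))=\dim T+\dim V+1-\dim\Delta$. A $\mathcal T$-pseudo-barycentric system $\mathcal B$ consists of a triangulation $\mathcal B_\sigma$ of $\Delta$ and a point $u_\sigma\in\Delta\setminus\partial\Delta$ for each singular simplex $\sigma\colon\Delta\to X$, such that: $\mathcal B_\sigma$ restricts to $\mathcal B_{\partial_i\sigma}$ on the $i$-th facet, for each $i$; $\mathcal B_\sigma=u_\sigma*\mathcal B_{\partial\sigma}$ if $\ell=\dim\Delta>0$; each simplex of $\mathcal B_\sigma$ has diameter at most $2\ell/(2\ell+1)$ (for the maximum metric on barycentric coordinates); and $\{T,u_\sigma*B\}$ is in strong general position for all $B\in\mathcal B_{\partial\sigma}$, all strata $S$ and all $T\in\mathcal T_{\sigma,S}$. It induces an operator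 $\mathrm{sd}$ on singular chains, by $\mathrm{sd}=\mathrm{id}$ in degree $0$ and $\mathrm{sd}\,\sigma=u_\sigma*\mathrm{sd}(\partial\sigma)$ in positive degrees; here $\mathrm{sd}(\partial\sigma)$ is a combination of restrictions $\sigma_F$ of $\sigma$ to (ordered) simplexes $F$ of $\mathcal B_{\partial\sigma}$, and $u_\sigma*\sigma_F$ is the restriction of $\sigma$ to $u_\sigma*F$, with first vertex $u_\sigma$. Statement. Let $X$ be a filtered space with locally finite stratification, $\overline p$ a perversity on $X$, $R$ a Dedekind ring and $G$ an $R$-module. Then simplicial systems of $X$ exist, and for every simplicial system $\mathcal T$ there is a $\mathcal T$-pseudo-barycentric system $\mathcal B$ whose operator $\mathrm{sd}\colon C_*(X;G)\to C_*(X;G)$ satisfies the following. 1. $\mathrm{sd}$ is a chain map of singular chains, and it sends $\overline p$-allowable chains to $\overline p$-allowable chains. 2. For every open covering $\mathcal U$ of $X$ and every singular simplex $\sigma$ there is $r\in\mathbb N$ such that, for every coefficient $g\in G$, the image of each singular simplex occurring in $\mathrm{sd}^r(g\sigma)$ is contained in an element of $\mathcal U$. 3. There is an $R$-linear map $T\colon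 C_*(X;G)\to C_{*+1}(X;G)$ with $\mathrm{id}-\mathrm{sd}=T\partial+\partial T$ that sends $\overline p$-allowable chains to $\overline p$-allowable chains. -/

import Mathlib

/-! Filtered spaces, perversities, polyhedral dimension, allowable singular chains, and
pseudo-barycentric subdivisions. -/

noncomputable section

namespace PseudoBary

/-! ### Filtered spaces, strata, perversities -/

/-- A filtration `∅ ⊆ X₀ ⊆ X₁ ⊆ ⋯ ⊆ Xₙ₋₁ ⊊ Xₙ = X` of a space by closed subspaces, indexed by `ℤ`
with `Xᵢ = ∅` for `i < 0`. The number `dim = n` is the (formal) dimension. -/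
structure Filtration (X : Type*) [TopologicalSpace X] where
  dim : ℕ
  skel : ℤ → Set X
  isClosed_skel : ∀ i, IsClosed (skel i)
  mono : Monotone skel
  skel_of_neg : ∀ i < 0, skel i = ∅
  skel_dim : skel dim = Set.univ
  skel_dim_sub_one_ne : skel (dim - 1) ≠ Set.univ

section Filtered

variable {X : Type*} [TopologicalSpace X]

/-- A (non-empty) stratum of dimension `i`: a connected component of `Xᵢ \ Xᵢ₋₁`. -/
structure Stratum (F : Filtration X) where
  dim : ℤ
  carrier : Set X
  isComponent : ∃ x ∈ F.skel dim \ F.skel (dim - 1),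
    carrier = connectedComponentIn (F.skel dim \ F.skel (dim - 1)) x

/-- The codimension of a stratum. -/
def Stratum.codim {F : Filtration X} (S : Stratum F) : ℤ := F.dim - S.dim

/-- The regular strata are the strata of `X \ Xₙ₋₁`. -/
def Stratum.IsRegular {F : Filtration X} (S : Stratum F) : Prop := S.dim = F.dim

/-- The singular strata are the strata that are not regular. -/
def Stratum.IsSingular {F : Filtration X} (S : Stratum F) : Prop := ¬ S.IsRegular

/-- Every point has a neighbourhood that meets only finitely many strata. -/
def Filtration.LocallyFinite (F : Filtration X) : Prop :=
  ∀ x : X, ∃ N ∈ nhds x, {S : Stratum F | (S.carrier ∩ N).Nonempty}.Finite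

/-- A perversity: a map from the strata to `ℤ ∪ {±∞}` that vanishes on the regular strata. -/
structure Perversity (F : Filtration X) where
  toFun : Stratum F → EInt
  map_regular : ∀ S : Stratum F, S.IsRegular → toFun S = ((0 : ℤ) : EInt)

end Filtered

/-! ### Euclidean simplexes and polyhedral dimension -/

section Polyhedral

variable {E : Type*} [AddCommGroup E] [Module ℝ E]

/-- A Euclidean simplex, given by its non-empty affinely independent set of vertices; the simplex
itself is `convexHull ℝ T`. -/
def IsSimplex (T : Finset E) : Prop :=
  T.Nonempty ∧ AffineIndependent ℝ (Subtype.val : {x // x ∈ T} → E)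

/-- The dimension of a simplex: the number of its vertices minus one. -/
def simplexDim (T : Finset E) : ℤ := (T.card : ℤ) - 1

/-- The interior of a simplex: the points all of whose barycentric coordinates are positive. -/
def openSimplex (T : Finset E) : Set E :=
  {x | ∃ w : E → ℝ, (∀ v ∈ T, 0 < w v) ∧ ∑ v ∈ T, w v = 1 ∧ ∑ v ∈ T, w v • v = x}

/-- The polyhedral dimension of a (bounded) set `A`: the least `d` such that `A` is included in a
finite union of simplexes of dimension at most `d`. It is `-∞` for the empty set. -/
def polyDim (A : Set E) : EInt :=
  sInf {d : EInt | ∃ 𝒬 : Finset (Finset E),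
    (∀ Q ∈ 𝒬, IsSimplex Q ∧ (simplexDim Q : EInt) ≤ d) ∧
      A ⊆ ⋃ Q ∈ 𝒬, convexHull ℝ (Q : Set E)}

end Polyhedral

/-! ### Singular simplexes and chains -/

/-- The standard `n`-simplex, a subspace of `ℝⁿ⁺¹ = Fin (n + 1) → ℝ` (with the maximum metric). -/
abbrev Simp (n : ℕ) : Set (Fin (n + 1) → ℝ) := stdSimplex ℝ (Fin (n + 1))

/-- Insertion of the coordinate `0` at place `i`, the inclusion of the `i`-th facet. -/
def facetIncl {n : ℕ} (i : Fin (n + 2)) (x : Fin (n + 1) → ℝ) : Fin (n + 2) → ℝ :=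
  i.insertNth (α := fun _ => ℝ) 0 x

lemma facetIncl_mem {n : ℕ} (i : Fin (n + 2)) {x : Fin (n + 1) → ℝ} (hx : x ∈ Simp n) :
    facetIncl i x ∈ Simp (n + 1) := by
  refine ⟨fun j => ?_, ?_⟩
  · refine Fin.succAboveCases i ?_ (fun k => ?_) j
    · simp [facetIncl]
    · simpa [facetIncl] using hx.1 k
  · rw [Fin.sum_univ_succAbove _ i]
    simpa [facetIncl] using hx.2

lemma continuous_facetIncl {n : ℕ} (i : Fin (n + 2)) : Continuous (facetIncl (n := n) i) := by
  refine continuous_pi fun j => ?_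
  refine Fin.succAboveCases i ?_ (fun k => ?_) j
  · simpa [facetIncl] using continuous_const
  · simpa [facetIncl] using continuous_apply k

/-- The inclusion of the `i`-th facet, as a continuous map of standard simplexes. -/
def coface {n : ℕ} (i : Fin (n + 2)) : C(Simp n, Simp (n + 1)) where
  toFun x := ⟨facetIncl i x, facetIncl_mem i x.2⟩
  continuous_toFun := ((continuous_facetIncl i).comp continuous_subtype_val).subtype_mk _

/-- The affine map `Δᵏ → Δⁿ` that sends the `j`-th vertex of `Δᵏ` to `v j`. -/
def affineSimplex {k n : ℕ} (v : Fin (k + 1) → Simp n) : C(Simp k, Simp n) where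
  toFun t := ⟨∑ j, t.1 j • (v j).1,
    (convex_stdSimplex ℝ (Fin (n + 1))).sum_mem (fun j _ => t.2.1 j) t.2.2 (fun j _ => (v j).2)⟩
  continuous_toFun := by
    refine Continuous.subtype_mk ?_ _
    exact continuous_finsetSum _ fun j _ =>
      ((continuous_apply j).comp continuous_subtype_val).smul continuous_const

/-- Singular `n`-simplexes of `X`. -/
abbrev Sing (X : Type*) [TopologicalSpace X] (n : ℕ) : Type _ := C(Simp n, X)

/-- Singular `n`-chains of `X` with coefficients in `G`. -/
abbrev Chain (X : Type*) [TopologicalSpace X] (G : Type*) [AddCommGroup G] (n : ℕ) : Type _ :=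
  Sing X n →₀ G

section Chains

variable {X : Type*} [TopologicalSpace X]

/-- The `i`-th face of a singular simplex. -/
def face {n : ℕ} (i : Fin (n + 2)) (σ : Sing X (n + 1)) : Sing X n := σ.comp (coface i)

/-- The boundary operator `∂ = ∑ᵢ (-1)ⁱ ∂ᵢ` on singular chains. -/
def boundary (X : Type*) [TopologicalSpace X] (R : Type*) [CommRing R] (G : Type*)
    [AddCommGroup G] [Module R G] (n : ℕ) : Chain X G (n + 1) →ₗ[R] Chain X G n :=
  Finsupp.lsum R fun σ => ∑ i : Fin (n + 2), ((-1 : ℤ) ^ (i : ℕ)) • Finsupp.lsingle (face i σ)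

/-- The subset `σ⁻¹(A)` of the standard simplex, seen in `ℝⁿ⁺¹`. -/
def preimage {n : ℕ} (σ : Sing X n) (A : Set X) : Set (Fin (n + 1) → ℝ) :=
  Subtype.val '' (σ ⁻¹' A)

/-- `σ : Δ → X` is `p`-allowable if `dim σ⁻¹(S) ≤ dim Δ - codim S + p(S)` for each singular
stratum `S`. -/
def Allowable {F : Filtration X} (p : Perversity F) {n : ℕ} (σ : Sing X n) : Prop :=
  ∀ S : Stratum F, S.IsSingular →
    polyDim (preimage σ S.carrier) ≤ (((n : ℤ) - S.codim : ℤ) : EInt) + p.toFun S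

/-- A chain is `p`-allowable if it is a linear combination of `p`-allowable simplexes. -/
def AllowableChain {F : Filtration X} (p : Perversity F) {G : Type*} [AddCommGroup G] {n : ℕ}
    (ξ : Chain X G n) : Prop :=
  ∀ σ ∈ ξ.support, Allowable p σ

end Chains

/-! ### Simplicial systems, strong general position -/

section Systems

variable {X : Type*} [TopologicalSpace X]

/-- A simplicial system: for each singular simplex `σ : Δ → X` and each stratum `S`, a simplicial
envelope of `σ⁻¹(S)`, that is, a finite family of simplexes of `Δ` that covers `σ⁻¹(S)` and whose
largest dimension is `dim σ⁻¹(S)`. (The supremum of the empty family is `-∞`, so that the envelope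
of the empty set is empty.) -/
structure SimplicialSystem (F : Filtration X) where
  env : ∀ {n : ℕ}, Sing X n → Stratum F → Finset (Finset (Fin (n + 1) → ℝ))
  isSimplex : ∀ {n : ℕ} (σ : Sing X n) (S : Stratum F), ∀ T ∈ env σ S, IsSimplex T
  subset_simp : ∀ {n : ℕ} (σ : Sing X n) (S : Stratum F), ∀ T ∈ env σ S,
    (T : Set (Fin (n + 1) → ℝ)) ⊆ Simp n
  covers : ∀ {n : ℕ} (σ : Sing X n) (S : Stratum F),
    preimage σ S.carrier ⊆ ⋃ T ∈ env σ S, convexHull ℝ (T : Set (Fin (n + 1) → ℝ))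
  dim_eq : ∀ {n : ℕ} (σ : Sing X n) (S : Stratum F),
    polyDim (preimage σ S.carrier) = (env σ S).sup fun T => (simplexDim T : EInt)

/-- The boundary of the standard simplex. -/
def bdry (n : ℕ) : Set (Fin (n + 1) → ℝ) := {x | x ∈ Simp n ∧ ∃ i, x i = 0}

/-- Strong general position in `Δⁿ` of the simplex `T` and of the cone `u * V`, where `V` is a
simplex of `∂Δⁿ` and `u` an interior point: either `T ∩ (u * V) ⊆ ∂Δ`, or the interiors of `T` and
of `u * V` meet and `dim (T ∩ (u * V)) = dim T + dim V + 1 - dim Δ`. -/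
def StrongGeneralPosition {n : ℕ} (T V : Finset (Fin (n + 1) → ℝ)) (u : Fin (n + 1) → ℝ) : Prop :=
  (convexHull ℝ (T : Set (Fin (n + 1) → ℝ)) ∩ convexHull ℝ (insert u V : Set (Fin (n + 1) → ℝ))
      ⊆ bdry n) ∨
  ((openSimplex T ∩ openSimplex (insert u V)).Nonempty ∧
    polyDim (convexHull ℝ (T : Set (Fin (n + 1) → ℝ)) ∩
        convexHull ℝ (insert u V : Set (Fin (n + 1) → ℝ))) =
      ((simplexDim T + simplexDim V + 1 - (n : ℤ) : ℤ) : EInt))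

/-! ### Pseudo-barycentric systems -/

/-- The simplexes of the `i`-th facet of `Δⁿ⁺¹` obtained by transport of a complex on `Δⁿ`. -/
def facetFaces {n : ℕ} (i : Fin (n + 2)) (K : Geometry.SimplicialComplex ℝ (Fin (n + 1) → ℝ)) :
    Set (Finset (Fin (n + 2) → ℝ)) :=
  (fun s => s.image (facetIncl i)) '' K.faces

/-- The simplexes of the triangulation `ℬ_{∂σ}` of `∂Δ` induced by triangulations `ℬ_{∂ᵢσ}`. -/
def boundaryFaces (tri : ∀ {n : ℕ}, Sing X n → Geometry.SimplicialComplex ℝ (Fin (n + 1) → ℝ))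
    {n : ℕ} (σ : Sing X (n + 1)) : Set (Finset (Fin (n + 2) → ℝ)) :=
  ⋃ i, facetFaces i (tri (face i σ))

/-- A pseudo-barycentric system with respect to a simplicial system `𝒯`: a choice, for each
singular simplex `σ : Δ → X`, of a pseudo-barycentre `u_σ` and of a triangulation `ℬ_σ` of `Δ`. -/
structure PseudoBarycentricSystem {F : Filtration X} (𝒯 : SimplicialSystem F) where
  center : ∀ {n : ℕ}, Sing X n → Simp n
  tri : ∀ {n : ℕ}, Sing X n → Geometry.SimplicialComplex ℝ (Fin (n + 1) → ℝ)
  tri_space : ∀ {n : ℕ} (σ : Sing X n), (tri σ).space = Simp n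
  /-- The pseudo-barycentre is an interior point of `Δ`. -/
  center_pos : ∀ {n : ℕ} (σ : Sing X n) (i : Fin (n + 1)), 0 < (center σ).1 i
  /-- The restriction of `ℬ_σ` to the `i`-th facet is `ℬ_{∂ᵢσ}`. -/
  tri_facet : ∀ {n : ℕ} (σ : Sing X (n + 1)) (i : Fin (n + 2)),
    {s ∈ (tri σ).faces | ∀ x ∈ s, x i = 0} = facetFaces i (tri (face i σ))
  /-- `ℬ_σ = u_σ * ℬ_{∂σ}` in positive dimensions. -/
  tri_cone : ∀ {n : ℕ} (σ : Sing X (n + 1)),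
    (tri σ).faces = boundaryFaces tri σ ∪ {{(center σ).1}} ∪
      (fun s => insert (center σ).1 s) '' boundaryFaces tri σ
  /-- The diameter of `ℬ_σ` is at most `2ℓ / (2ℓ + 1)`, where `ℓ = dim Δ`. -/
  diam_le : ∀ {n : ℕ} (σ : Sing X n), ∀ s ∈ (tri σ).faces,
    Metric.diam (convexHull ℝ (s : Set (Fin (n + 1) → ℝ))) ≤ 2 * (n : ℝ) / (2 * n + 1)
  /-- Each `u_σ * B`, with `B` in `ℬ_{∂σ}`, is in strong general position with each simplex of the
  envelopes of `σ`. -/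
  general_position : ∀ {n : ℕ} (σ : Sing X (n + 1)), ∀ B ∈ boundaryFaces tri σ, ∀ S : Stratum F,
    ∀ T ∈ 𝒯.env σ S, StrongGeneralPosition T B (center σ).1

/-! ### The subdivision operator -/

/-- The subdivision of the identity chain of `Δ_σ`, as an integral combination of affine simplexes
of `Δ_σ` given by their ordered vertices. It is the cone, with apex `u_σ`, of the alternating sum
over `i` of the subdivisions for the faces `∂ᵢσ`. -/
def sdModel (u : ∀ {n : ℕ}, Sing X n → Simp n) :
    ∀ {n : ℕ}, Sing X n → ((Fin (n + 1) → Simp n) →₀ ℤ)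
  | 0, σ => Finsupp.single (fun _ => u σ) 1
  | n + 1, σ => ∑ i : Fin (n + 2), ((-1 : ℤ) ^ (i : ℕ)) •
      (sdModel u (face i σ)).mapDomain
        (fun v => (Fin.cons (u σ) (fun j => coface i (v j)) : Fin (n + 2) → Simp (n + 1)))

/-- The operator on singular chains with `sd σ = u_σ * sd (∂σ)` (and `sd = id` in degree `0`). -/
def sd (R : Type*) [CommRing R] (G : Type*) [AddCommGroup G] [Module R G]
    (u : ∀ {n : ℕ}, Sing X n → Simp n) (n : ℕ) : Chain X G n →ₗ[R] Chain X G n :=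
  Finsupp.lsum R fun σ =>
    (sdModel u σ).sum fun v m => m • Finsupp.lsingle (σ.comp (affineSimplex v))

end Systems

end PseudoBary

end

noncomputable section

namespace PseudoBary

open Module Topology

/-! ### Extended integers -/

/-! The standard simplex lies in the hyperplane of coordinate sum 1, which misses the origin. Affine
independence of its points is therefore linear independence, and a subset has polyhedral dimension
at most `k` exactly when finitely many linear subspaces of rank at most `k + 1` cover it
(`exists_simplexes_of_subset_submodules`). Dimension counts become linear algebra.

Allowability: an affine simplex `Δᵐ → Δⁿ` whose vertices span `ℝⁿ⁺¹` is the restriction of a linear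
surjection with kernel of rank `m - n`. Pulling back along it raises dimensions by at most `m - n`,
the amount by which the bound in the definition of allowability grows
(`Allowable.comp_affineSimplex`). All simplexes occurring in `sd` (`m = n`) and in the homotopy (`m
= n + 1`) span, because the pseudo-barycentres are interior.

Existence of the system: by compactness and local finiteness, a singular simplex has only finitely
many envelope simplexes. Strong general position follows if `u` avoids the proper subspaces among
the spans of faces of `T` and of `B` (`strongGeneralPosition_of_generic`). These are finitely many
null sets, so a generic point near the barycentre works. Dimension by dimension, the boundary
triangulations agree on common faces by the simplicial identities, and coning from `u` extends them.

Smallness: all coordinates of `u` are kept at least `c = 1 / (2n + 1)`. Inductively, the vertices of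
each subdivision simplex share a coordinate at least `c`. This gives the diameter bound `1 - c = 2n
/ (2n + 1)` and makes each affine piece an `ℓ¹` contraction of ratio `1 - c`. Ratios multiply under
iteration, and a Lebesgue number finishes.

Algebra: with `∂(u * c) = c - u * ∂c`, both the chain map property and the homotopy `T σ = u * (σ -
T ∂σ)` are identities between integral affine chains of `Δ`, pushed forward by `σ`. -/

lemma eint_coe_le_coe {a b : ℤ} : (a : EInt) ≤ (b : EInt) ↔ a ≤ b := by
  change ((a : WithTop ℤ) : WithBot (WithTop ℤ)) ≤ ((b : WithTop ℤ) : WithBot (WithTop ℤ)) ↔ _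
  rw [WithBot.coe_le_coe, WithTop.coe_le_coe]

lemma eint_bot_lt_coe (a : ℤ) : (⊥ : EInt) < (a : EInt) :=
  WithBot.bot_lt_coe (a : WithTop ℤ)

lemma eint_cases (d : EInt) : d = ⊥ ∨ d = ⊤ ∨ ∃ a : ℤ, d = (a : EInt) := by
  rcases d with _ | _ | a
  · exact Or.inl rfl
  · exact Or.inr (Or.inl rfl)
  · exact Or.inr (Or.inr ⟨a, rfl⟩)

/-! ### Linear algebra in the hyperplane of the standard simplex -/

section Linear

variable {n : ℕ}

lemma sum_smul_coord {ι : Type*} {s : Finset ι} {v : ι → Fin (n + 1) → ℝ}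
    (hv : ∀ i ∈ s, ∑ j, v i j = 1) (w : ι → ℝ) :
    ∑ j, (∑ i ∈ s, w i • v i) j = ∑ i ∈ s, w i := by
  simp only [Finset.sum_apply, Pi.smul_apply, smul_eq_mul]
  rw [Finset.sum_comm]
  refine Finset.sum_congr rfl fun i hi => ?_
  rw [← Finset.mul_sum, hv i hi, mul_one]

/-- All points have coordinate sum 1, so a linear relation between them has total weight zero and is
an affine relation. -/
lemma linearIndependent_of_affineIndependent {ι : Type*} {v : ι → Fin (n + 1) → ℝ}
    (hv : ∀ i, v i ∈ Simp n) (h : AffineIndependent ℝ v) : LinearIndependent ℝ v := by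
  rw [linearIndependent_iff']
  intro s w hw
  refine affineIndependent_iff.1 h s w ?_ hw
  have := sum_smul_coord (s := s) (fun i _ => (hv i).2) w
  rw [hw] at this
  simpa using this.symm

lemma IsSimplex.linearIndependent {T : Finset (Fin (n + 1) → ℝ)} (h : IsSimplex T)
    (hT : (T : Set (Fin (n + 1) → ℝ)) ⊆ Simp n) :
    LinearIndependent ℝ (Subtype.val : {x // x ∈ T} → Fin (n + 1) → ℝ) :=
  linearIndependent_of_affineIndependent (fun i => hT i.2) h.2

lemma finrank_span_of_linearIndependent {E : Type*} [AddCommGroup E] [Module ℝ E] {T : Finset E}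
    (h : LinearIndependent ℝ (Subtype.val : {x // x ∈ T} → E)) :
    finrank ℝ (Submodule.span ℝ (T : Set E)) = T.card :=
  finrank_span_finset_eq_card h

lemma convexHull_subset_span {E : Type*} [AddCommGroup E] [Module ℝ E] (s : Set E) :
    convexHull ℝ s ⊆ Submodule.span ℝ s :=
  convexHull_min Submodule.subset_span (Submodule.convex _)

/-- Proper subspaces are null for Haar measure, whereas a non-empty open set has positive measure.
-/
lemma exists_mem_forall_notMem_submodule {V : Type*} [NormedAddCommGroup V] [NormedSpace ℝ V]
    [FiniteDimensional ℝ V] {U : Set V} (hU : IsOpen U) (hne : U.Nonempty)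
    {𝒲 : Set (Submodule ℝ V)} (hfin : 𝒲.Finite) (h : ∀ W ∈ 𝒲, W ≠ ⊤) :
    ∃ x ∈ U, ∀ W ∈ 𝒲, x ∉ W := by
  let _ : MeasurableSpace V := borel V
  have : BorelSpace V := ⟨rfl⟩
  by_contra! hc
  have hsub : U ⊆ ⋃ W ∈ 𝒲, (W : Set V) := fun x hx => by
    obtain ⟨W, hW, hxW⟩ := hc x hx
    exact Set.mem_biUnion hW hxW
  have h0 : (MeasureTheory.Measure.addHaar : MeasureTheory.Measure V) (⋃ W ∈ 𝒲, (W : Set V)) = 0 :=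
    (MeasureTheory.measure_biUnion_null_iff hfin.countable).2 fun W hW =>
      MeasureTheory.Measure.addHaar_submodule _ W (h W hW)
  exact (hU.measure_pos MeasureTheory.Measure.addHaar hne).ne'
    (MeasureTheory.measure_mono_null hsub h0)

/-- A linear section of the standard simplex is a finite union of simplexes of the expected
dimension. -/
lemma exists_simplexes_inter_submodule (W : Submodule ℝ (Fin (n + 1) → ℝ)) :
    ∃ 𝒬 : Finset (Finset (Fin (n + 1) → ℝ)),
      (∀ Q ∈ 𝒬, IsSimplex Q ∧ (Q : Set (Fin (n + 1) → ℝ)) ⊆ Simp n ∧ Q.card ≤ finrank ℝ W) ∧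
      Simp n ∩ W ⊆ ⋃ Q ∈ 𝒬, convexHull ℝ (Q : Set (Fin (n + 1) → ℝ)) := by
  classical
  set K : Set (Fin (n + 1) → ℝ) := Simp n ∩ W with hK
  have hcomp : IsCompact K :=
    (isCompact_stdSimplex (𝕜 := ℝ) (Fin (n + 1))).inter_right (Submodule.closed_of_finiteDimensional W)
  have hconv : Convex ℝ K := (convex_stdSimplex ℝ _).inter W.convex
  -- An extreme point of `K` is determined by its support: if `x` and `y` have the same support,
  -- then `x ± ε (x - y)` lie in `K` for small `ε > 0`, and `x` is their midpoint.
  have hfin : (K.extremePoints ℝ).Finite := by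
    refine Set.Finite.of_finite_image (f := fun x => Finset.univ.filter fun i => x i ≠ 0)
      (Set.toFinite _) ?_
    intro x hx y hy hxy
    simp only at hxy
    have hsupp : ∀ i, x i = 0 → y i = 0 := fun i hi => by
      by_contra h
      have : i ∈ Finset.univ.filter fun i => y i ≠ 0 := by simpa using h
      rw [← hxy] at this
      simp [hi] at this
    have hx1 := hx.1
    have hy1 := hy.1
    have hev : ∀ᶠ ε in 𝓝[>] (0 : ℝ), ∀ i, 0 ≤ x i + ε * (x i - y i) ∧ 0 ≤ x i - ε * (x i - y i) := by
      rw [Filter.eventually_all]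
      intro i
      rcases (hx1.1.1 i).eq_or_lt with h | h
      · have := hsupp i h.symm
        refine Filter.Eventually.of_forall fun ε => ?_
        simp [← h, this]
      · refine Filter.Eventually.filter_mono nhdsWithin_le_nhds ?_
        have c1 : Filter.Tendsto (fun ε : ℝ => x i + ε * (x i - y i)) (𝓝 0) (𝓝 (x i)) :=
          Continuous.tendsto' (by fun_prop) _ _ (by simp)
        have c2 : Filter.Tendsto (fun ε : ℝ => x i - ε * (x i - y i)) (𝓝 0) (𝓝 (x i)) :=
          Continuous.tendsto' (by fun_prop) _ _ (by simp)
        filter_upwards [c1.eventually (lt_mem_nhds h), c2.eventually (lt_mem_nhds h)] with ε h1 h2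
        exact ⟨h1.le, h2.le⟩
    obtain ⟨ε, hε, hε0⟩ := (hev.and self_mem_nhdsWithin).exists
    have hε0 : 0 < ε := hε0
    have m1 : x + ε • (x - y) ∈ K := by
      refine ⟨⟨fun i => (hε i).1, ?_⟩, W.add_mem hx1.2 (W.smul_mem _ (W.sub_mem hx1.2 hy1.2))⟩
      simp [Finset.sum_add_distrib, ← Finset.mul_sum, hx1.1.2, hy1.1.2]
    have m2 : x - ε • (x - y) ∈ K := by
      refine ⟨⟨fun i => (hε i).2, ?_⟩, W.sub_mem hx1.2 (W.smul_mem _ (W.sub_mem hx1.2 hy1.2))⟩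
      simp [← Finset.mul_sum, hx1.1.2, hy1.1.2]
    have hseg : x ∈ openSegment ℝ (x + ε • (x - y)) (x - ε • (x - y)) := by
      refine ⟨1 / 2, 1 / 2, by norm_num, by norm_num, by norm_num, ?_⟩
      ext i
      simp
      ring
    have := hx.2 m1 m2 hseg
    have h0 : ε • (x - y) = 0 := by simpa using this
    rcases smul_eq_zero.1 h0 with h | h
    · exact absurd h hε0.ne'
    · exact sub_eq_zero.1 h
  have hKe : K = convexHull ℝ (K.extremePoints ℝ) := by
    have h := closure_convexHull_extremePoints hcomp hconv
    rw [(Set.Finite.isClosed_convexHull ℝ hfin).closure_eq] at h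
    exact h.symm
  have hsub : ∀ x ∈ K.extremePoints ℝ, x ∈ K := fun x hx => hx.1
  refine ⟨hfin.toFinset.powerset.filter fun Q => IsSimplex Q, ?_, ?_⟩
  · intro Q hQ
    rw [Finset.mem_filter, Finset.mem_powerset] at hQ
    have hQK : ∀ x ∈ Q, x ∈ K := fun x hx => hsub x (hfin.mem_toFinset.1 (hQ.1 hx))
    have hQS : (Q : Set (Fin (n + 1) → ℝ)) ⊆ Simp n := fun x hx => (hQK x hx).1
    refine ⟨hQ.2, hQS, ?_⟩
    rw [← finrank_span_of_linearIndependent (hQ.2.linearIndependent hQS)]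
    exact Submodule.finrank_mono (Submodule.span_le.2 fun x hx => (hQK x hx).2)
  · intro x hx
    -- Carathéodory: each point of the polytope lies in a simplex spanned by extreme points.
    rw [hKe, convexHull_eq_union] at hx
    simp only [Set.mem_iUnion] at hx ⊢
    obtain ⟨Q, hQs, hQi, hxQ⟩ := hx
    refine ⟨Q, ?_, hxQ⟩
    rw [Finset.mem_filter, Finset.mem_powerset]
    refine ⟨fun y hy => hfin.mem_toFinset.2 (hQs hy), ?_, hQi⟩
    have : (convexHull ℝ (Q : Set (Fin (n + 1) → ℝ))).Nonempty := ⟨x, hxQ⟩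
    simpa using this

/-- Each linear section of `Δ` splits into simplexes of `Δ`, so upper bounds on dimension only
require covering subspaces. -/
lemma exists_simplexes_of_subset_submodules {A : Set (Fin (n + 1) → ℝ)} (hA : A ⊆ Simp n)
    {ι : Type*} (s : Finset ι) (W : ι → Submodule ℝ (Fin (n + 1) → ℝ))
    (hAW : ∀ x ∈ A, ∃ i ∈ s, x ∈ W i) {k : ℤ} (hk : ∀ i ∈ s, (finrank ℝ (W i) : ℤ) ≤ k + 1) :
    ∃ 𝒬 : Finset (Finset (Fin (n + 1) → ℝ)),
      (∀ Q ∈ 𝒬, IsSimplex Q ∧ (Q : Set (Fin (n + 1) → ℝ)) ⊆ Simp n ∧ simplexDim Q ≤ k) ∧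
      A ⊆ ⋃ Q ∈ 𝒬, convexHull ℝ (Q : Set (Fin (n + 1) → ℝ)) := by
  classical
  choose 𝒬 h𝒬 hcov using fun i => exists_simplexes_inter_submodule (W i)
  refine ⟨s.biUnion 𝒬, fun Q hQ => ?_, fun x hx => ?_⟩
  · obtain ⟨i, hi, hQi⟩ := Finset.mem_biUnion.1 hQ
    obtain ⟨h1, h2, h3⟩ := h𝒬 i Q hQi
    refine ⟨h1, h2, ?_⟩
    have := hk i hi
    unfold simplexDim
    omega
  · obtain ⟨i, hi, hxi⟩ := hAW x hx
    have := hcov i ⟨hA hx, hxi⟩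
    simp only [Set.mem_iUnion] at this ⊢
    obtain ⟨Q, hQ, hxQ⟩ := this
    exact ⟨Q, Finset.mem_biUnion.2 ⟨i, hi, hQ⟩, hxQ⟩

end Linear

/-! ### Polyhedral dimension -/

section PolyDim

lemma IsSimplex.simplexDim_nonneg {E : Type*} [AddCommGroup E] [Module ℝ E] {T : Finset E}
    (h : IsSimplex T) : 0 ≤ simplexDim T := by
  have := h.1.card_pos
  unfold simplexDim
  omega

lemma polyDim_le {E : Type*} [AddCommGroup E] [Module ℝ E] {A : Set E} {k : ℤ}
    (𝒬 : Finset (Finset E)) (h𝒬 : ∀ Q ∈ 𝒬, IsSimplex Q ∧ simplexDim Q ≤ k)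
    (hA : A ⊆ ⋃ Q ∈ 𝒬, convexHull ℝ (Q : Set E)) : polyDim A ≤ (k : EInt) :=
  sInf_le ⟨𝒬, fun Q hQ => ⟨(h𝒬 Q hQ).1, eint_coe_le_coe.2 (h𝒬 Q hQ).2⟩, hA⟩

lemma polyDim_empty {E : Type*} [AddCommGroup E] [Module ℝ E] : polyDim (∅ : Set E) = ⊥ :=
  le_bot_iff.1 (sInf_le ⟨∅, by simp, by simp⟩)

variable {n : ℕ}

lemma polyDim_le_of_subset_submodules {A : Set (Fin (n + 1) → ℝ)} (hA : A ⊆ Simp n)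
    {ι : Type*} (s : Finset ι) (W : ι → Submodule ℝ (Fin (n + 1) → ℝ))
    (hAW : ∀ x ∈ A, ∃ i ∈ s, x ∈ W i) {k : ℤ} (hk : ∀ i ∈ s, (finrank ℝ (W i) : ℤ) ≤ k + 1) :
    polyDim A ≤ (k : EInt) := by
  obtain ⟨𝒬, h1, h2⟩ := exists_simplexes_of_subset_submodules hA s W hAW hk
  exact polyDim_le 𝒬 (fun Q hQ => ⟨(h1 Q hQ).1, (h1 Q hQ).2.2⟩) h2

/-- The dimension of a non-empty subset of the standard simplex is realized by a family of
simplexes of the standard simplex. -/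
lemma exists_polyDim_eq {A : Set (Fin (n + 1) → ℝ)} (hA : A ⊆ Simp n) (hne : A.Nonempty) :
    ∃ k : ℤ, polyDim A = (k : EInt) ∧ ∃ 𝒬 : Finset (Finset (Fin (n + 1) → ℝ)),
      (∀ Q ∈ 𝒬, IsSimplex Q ∧ (Q : Set (Fin (n + 1) → ℝ)) ⊆ Simp n ∧ simplexDim Q ≤ k) ∧
      A ⊆ ⋃ Q ∈ 𝒬, convexHull ℝ (Q : Set (Fin (n + 1) → ℝ)) := by
  classical
  let P : ℕ → Prop := fun k => ∃ 𝒬 : Finset (Finset (Fin (n + 1) → ℝ)),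
      (∀ Q ∈ 𝒬, IsSimplex Q ∧ (Q : Set (Fin (n + 1) → ℝ)) ⊆ Simp n ∧ simplexDim Q ≤ k) ∧
      A ⊆ ⋃ Q ∈ 𝒬, convexHull ℝ (Q : Set (Fin (n + 1) → ℝ))
  have hP : ∃ k, P k :=
    ⟨n, exists_simplexes_of_subset_submodules hA (s := {()}) (fun _ => ⊤)
      (fun _ _ => ⟨(), by simp, trivial⟩) (by simp)⟩
  obtain ⟨𝒬, h𝒬, hcov⟩ := Nat.find_spec hP
  refine ⟨Nat.find hP, le_antisymm
    (polyDim_le 𝒬 (fun Q hQ => ⟨(h𝒬 Q hQ).1, (h𝒬 Q hQ).2.2⟩) hcov) (le_sInf ?_), 𝒬, h𝒬, hcov⟩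
  rintro d ⟨𝒬', h𝒬', hcov'⟩
  have hne' : ∃ Q, Q ∈ 𝒬' := by
    obtain ⟨x, hx⟩ := hne
    have := hcov' hx
    simp only [Set.mem_iUnion] at this
    exact ⟨_, this.choose_spec.choose⟩
  obtain ⟨Q₀, hQ₀⟩ := hne'
  rcases eint_cases d with rfl | rfl | ⟨a, rfl⟩
  · exact absurd (h𝒬' Q₀ hQ₀).2 (not_le.2 (eint_bot_lt_coe _))
  · exact le_top
  · have h0 : 0 ≤ a := (h𝒬' Q₀ hQ₀).1.simplexDim_nonneg.trans
      (eint_coe_le_coe.1 (h𝒬' Q₀ hQ₀).2)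
    obtain ⟨m, rfl⟩ := Int.eq_ofNat_of_zero_le h0
    rw [eint_coe_le_coe]
    refine Nat.cast_le.2 (Nat.find_min' hP ?_)
    -- The competing simplexes may leave `Δ`; the sections of `Δ` by their spans replace them
    -- without increase of dimension.
    refine exists_simplexes_of_subset_submodules hA 𝒬' (fun Q => Submodule.span ℝ (Q : Set _)) ?_ ?_
    · intro x hx
      have := hcov' hx
      simp only [Set.mem_iUnion] at this
      obtain ⟨Q, hQ, hxQ⟩ := this
      exact ⟨Q, hQ, convexHull_subset_span _ hxQ⟩
    · intro Q hQ
      have h1 : finrank ℝ (Submodule.span ℝ (Q : Set (Fin (n + 1) → ℝ))) ≤ Q.card :=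
        finrank_span_finset_le_card Q
      have h2 := eint_coe_le_coe.1 (h𝒬' Q hQ).2
      unfold simplexDim at h2
      omega

/-- A set that contains, up to scaling, a non-empty open part of a linear subspace has at least
the expected dimension. -/
lemma le_polyDim_of_open {W : Submodule ℝ (Fin (n + 1) → ℝ)} {U A : Set (Fin (n + 1) → ℝ)}
    (hU : IsOpen U) (hne : (U ∩ W).Nonempty)
    (hA : ∀ y ∈ U, y ∈ W → ∃ c : ℝ, c ≠ 0 ∧ c • y ∈ A) :
    (((finrank ℝ W : ℤ) - 1 : ℤ) : EInt) ≤ polyDim A := by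
  classical
  refine le_sInf ?_
  rintro d ⟨𝒬, h𝒬, hcov⟩
  by_contra hd
  -- A covering simplex whose span contains `W` already has dimension at least `finrank W - 1`.
  -- Otherwise the spans cut `W` in proper subspaces, which cannot cover an open part of `W`. Spans
  -- are stable under scaling, so hitting `A` up to a scalar suffices.
  have hW : ∀ W' ∈ (fun Q : Finset (Fin (n + 1) → ℝ) =>
      (Submodule.span ℝ (Q : Set (Fin (n + 1) → ℝ))).comap W.subtype) '' (𝒬 : Set _), W' ≠ ⊤ := by
    rintro _ ⟨Q, hQ, rfl⟩ htop
    have h1 : finrank ℝ (Submodule.span ℝ (Q : Set (Fin (n + 1) → ℝ))) ≤ Q.card :=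
      finrank_span_finset_le_card Q
    have h2 := (h𝒬 Q hQ).2
    have h3 : finrank ℝ W ≤ finrank ℝ (Submodule.span ℝ (Q : Set (Fin (n + 1) → ℝ))) :=
      Submodule.finrank_mono (Submodule.comap_subtype_eq_top.1 htop)
    refine hd (le_trans (eint_coe_le_coe.2 ?_) h2)
    unfold simplexDim
    omega
  obtain ⟨x, hx⟩ := hne
  obtain ⟨y, hyU, hy⟩ := exists_mem_forall_notMem_submodule
    (hU.preimage continuous_subtype_val) ⟨⟨x, hx.2⟩, hx.1⟩ ((Finset.finite_toSet 𝒬).image _) hW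
  obtain ⟨c, hc, hcA⟩ := hA y hyU y.2
  have := hcov hcA
  simp only [Set.mem_iUnion] at this
  obtain ⟨Q, hQ, hQc⟩ := this
  refine hy _ ⟨Q, hQ, rfl⟩ ?_
  have h1 := convexHull_subset_span _ hQc
  exact (Submodule.smul_mem_iff _ hc).1 h1

end PolyDim

/-! ### Dimension and allowability under affine reparametrization. -/

section Transport

variable {n : ℕ} {X : Type*} [TopologicalSpace X]

lemma finrank_comap_le {E F : Type*} [AddCommGroup E] [Module ℝ E] [FiniteDimensional ℝ E]
    [AddCommGroup F] [Module ℝ F] [FiniteDimensional ℝ F] (L : E →ₗ[ℝ] F) (S : Submodule ℝ F) :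
    finrank ℝ (S.comap L) ≤ finrank ℝ S + finrank ℝ (LinearMap.ker L) := by
  rw [← LinearMap.finrank_range_add_finrank_ker (L.domRestrict (S.comap L))]
  refine add_le_add (Submodule.finrank_mono ?_) ?_
  · rintro _ ⟨x, rfl⟩
    exact x.2
  · refine LinearMap.finrank_le_finrank_of_injective
      (f := ((S.comap L).subtype ∘ₗ (LinearMap.ker (L.domRestrict (S.comap L))).subtype).codRestrict
        (LinearMap.ker L) fun x => x.2) fun x y hxy => ?_
    exact Subtype.ext (Subtype.ext (congrArg (fun z => z.1) hxy))

lemma preimage_subset_simp (σ : Sing X n) (A : Set X) : preimage σ A ⊆ Simp n := by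
  rintro _ ⟨x, -, rfl⟩
  exact x.2

/-- The spans of a minimal cover of `σ⁻¹(A)` are pulled back by the linear extension of the affine
simplex. It is onto, so by rank-nullity each rank grows by at most the rank `m - n` of its kernel.
-/
lemma polyDim_preimage_comp_affineSimplex_le {m : ℕ} (σ : Sing X n) (v : Fin (m + 1) → Simp n)
    (hv : Submodule.span ℝ (Set.range fun j => (v j).1) = ⊤) (A : Set X) :
    polyDim (preimage (σ.comp (affineSimplex v)) A) ≤
      (((m : ℤ) - n : ℤ) : EInt) + polyDim (preimage σ A) := by
  rcases (preimage σ A).eq_empty_or_nonempty with h | h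
  · have : preimage (σ.comp (affineSimplex v)) A = ∅ := by
      rw [Set.eq_empty_iff_forall_notMem]
      rintro _ ⟨x, hx, rfl⟩
      have : (affineSimplex v x).1 ∈ preimage σ A := ⟨_, hx, rfl⟩
      rw [h] at this
      exact this
    rw [this, polyDim_empty]
    exact bot_le
  obtain ⟨k, hk, 𝒬, h𝒬, hcov⟩ := exists_polyDim_eq (preimage_subset_simp σ A) h
  rw [hk]
  let L : (Fin (m + 1) → ℝ) →ₗ[ℝ] (Fin (n + 1) → ℝ) :=
    Fintype.linearCombination ℝ (fun j => (v j).1)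
  have hker : finrank ℝ (LinearMap.ker L) + n = m := by
    have h1 := LinearMap.finrank_range_add_finrank_ker L
    have h2 : LinearMap.range L = ⊤ := by rw [← hv]; exact Fintype.range_linearCombination ℝ _
    rw [h2, finrank_top] at h1
    simp only [finrank_fintype_fun_eq_card, Fintype.card_fin] at h1
    omega
  change _ ≤ (((m : ℤ) - n + k : ℤ) : EInt)
  refine polyDim_le_of_subset_submodules (preimage_subset_simp _ A) 𝒬
    (fun Q => (Submodule.span ℝ (Q : Set (Fin (n + 1) → ℝ))).comap L) ?_ ?_
  · rintro _ ⟨x, hx, rfl⟩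
    have : (affineSimplex v x).1 ∈ preimage σ A := ⟨_, hx, rfl⟩
    have := hcov this
    simp only [Set.mem_iUnion] at this
    obtain ⟨Q, hQ, hxQ⟩ := this
    exact ⟨Q, hQ, convexHull_subset_span _ hxQ⟩
  · intro Q hQ
    have h1 : finrank ℝ (Submodule.span ℝ (Q : Set (Fin (n + 1) → ℝ))) ≤ Q.card :=
      finrank_span_finset_le_card Q
    have h2 := (h𝒬 Q hQ).2.2
    have h3 := finrank_comap_le L (Submodule.span ℝ (Q : Set (Fin (n + 1) → ℝ)))
    unfold simplexDim at h2
    omega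

/-- The possible growth `m - n` of the preimage equals the change of `dim Δ` in the allowability
bound. -/
lemma Allowable.comp_affineSimplex {F : Filtration X} {p : Perversity F} {m : ℕ} {σ : Sing X n}
    (hσ : Allowable p σ) {v : Fin (m + 1) → Simp n}
    (hv : Submodule.span ℝ (Set.range fun j => (v j).1) = ⊤) :
    Allowable p (σ.comp (affineSimplex v)) := by
  intro S hS
  refine (polyDim_preimage_comp_affineSimplex_le σ v hv _).trans ?_
  refine (add_le_add_right (hσ S hS) _).trans ?_
  rw [← add_assoc]
  refine add_le_add_left (le_of_eq ?_) _
  change (((m : ℤ) - n + (n - S.codim) : ℤ) : EInt) = _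
  congr 1
  ring

end Transport

/-! ### Existence of simplicial systems -/

section Existence

variable {n : ℕ} {X : Type*} [TopologicalSpace X]

lemma exists_envelope (σ : Sing X n) (A : Set X) :
    ∃ 𝒬 : Finset (Finset (Fin (n + 1) → ℝ)),
      (∀ Q ∈ 𝒬, IsSimplex Q) ∧ (∀ Q ∈ 𝒬, (Q : Set (Fin (n + 1) → ℝ)) ⊆ Simp n) ∧
      preimage σ A ⊆ ⋃ Q ∈ 𝒬, convexHull ℝ (Q : Set (Fin (n + 1) → ℝ)) ∧
      polyDim (preimage σ A) = 𝒬.sup fun Q => (simplexDim Q : EInt) := by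
  rcases (preimage σ A).eq_empty_or_nonempty with h | h
  · exact ⟨∅, by simp, by simp, by simp [h], by simp [h, polyDim_empty]⟩
  obtain ⟨k, hk, 𝒬, h𝒬, hcov⟩ := exists_polyDim_eq (preimage_subset_simp σ A) h
  refine ⟨𝒬, fun Q hQ => (h𝒬 Q hQ).1, fun Q hQ => (h𝒬 Q hQ).2.1, hcov, le_antisymm ?_ ?_⟩
  · exact sInf_le ⟨𝒬, fun Q hQ => ⟨(h𝒬 Q hQ).1,
      Finset.le_sup (f := fun Q => (simplexDim Q : EInt)) hQ⟩, hcov⟩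
  · rw [hk]
    exact Finset.sup_le fun Q hQ => eint_coe_le_coe.2 (h𝒬 Q hQ).2.2

lemma nonempty_simplicialSystem (F : Filtration X) : Nonempty (SimplicialSystem F) := by
  choose env h1 h2 h3 h4 using
    fun (n : ℕ) (σ : Sing X n) (S : Stratum F) => exists_envelope σ S.carrier
  exact ⟨⟨fun {n} => env n, fun {n} => h1 n, fun {n} => h2 n, fun {n} => h3 n, fun {n} => h4 n⟩⟩

/-- A member of the envelope forces the supremum of dimensions above `-∞`, so `σ⁻¹(S)` cannot be
empty. -/
lemma SimplicialSystem.nonempty_of_mem_env {F : Filtration X} (𝒯 : SimplicialSystem F)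
    {σ : Sing X n} {S : Stratum F} {T : Finset (Fin (n + 1) → ℝ)} (hT : T ∈ 𝒯.env σ S) :
    (S.carrier ∩ Set.range σ).Nonempty := by
  by_contra hne
  have hempty : preimage σ S.carrier = ∅ := by
    rw [Set.eq_empty_iff_forall_notMem]
    rintro _ ⟨x, hx, rfl⟩
    exact hne ⟨_, hx, x, rfl⟩
  have := 𝒯.dim_eq σ S
  rw [hempty, polyDim_empty] at this
  have h2 := Finset.le_sup (f := fun T => (simplexDim T : EInt)) hT
  rw [← this] at h2
  exact absurd h2 (not_le.2 (eint_bot_lt_coe _))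

lemma Filtration.LocallyFinite.finite_of_isCompact {F : Filtration X} (hF : F.LocallyFinite)
    {K : Set X} (hK : IsCompact K) : {S : Stratum F | (S.carrier ∩ K).Nonempty}.Finite := by
  choose N hN hfin using hF
  obtain ⟨t, -, ht⟩ := hK.elim_nhds_subcover N fun x _ => hN x
  refine (t.finite_toSet.biUnion fun x _ => hfin x).subset ?_
  rintro S ⟨y, hyS, hyK⟩
  obtain ⟨x, hx, hyx⟩ := Set.mem_iUnion₂.1 (ht hyK)
  exact Set.mem_biUnion hx ⟨y, hyS, hyx⟩

/-- The image of `σ` is compact, so it meets finitely many strata. Hence general position with all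
envelopes amounts to finitely many conditions. -/
lemma SimplicialSystem.finite_env {F : Filtration X} (hF : F.LocallyFinite)
    (𝒯 : SimplicialSystem F) (σ : Sing X n) : {T | ∃ S : Stratum F, T ∈ 𝒯.env σ S}.Finite := by
  have hK : IsCompact (Set.range σ) := by
    have : CompactSpace (Simp n) := isCompact_iff_compactSpace.1 (isCompact_stdSimplex (𝕜 := ℝ) (Fin (n + 1)))
    exact isCompact_range σ.continuous
  refine ((hF.finite_of_isCompact hK).biUnion fun S _ => (𝒯.env σ S).finite_toSet).subset ?_
  rintro T ⟨S, hT⟩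
  exact Set.mem_biUnion (𝒯.nonempty_of_mem_env hT) hT

end Existence

/-! ### General position -/

section GeneralPosition

variable {n : ℕ}

/-- The positive combinations of a finite set of vectors. -/
def openCone (T : Finset (Fin (n + 1) → ℝ)) : Set (Fin (n + 1) → ℝ) :=
  {x | ∃ w : (Fin (n + 1) → ℝ) → ℝ, (∀ v ∈ T, 0 < w v) ∧ ∑ v ∈ T, w v • v = x}

/-- Cones allow perturbations that leave the hyperplane of coordinate sum 1; normalization brings
the result back to the simplex. -/
lemma openCone_smul_mem {T : Finset (Fin (n + 1) → ℝ)} (hT : ∀ v ∈ T, v ∈ Simp n)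
    {x : Fin (n + 1) → ℝ} (hx : x ∈ openCone T) (h0 : ∑ j, x j ≠ 0) :
    (∑ j, x j)⁻¹ • x ∈ openSimplex T := by
  obtain ⟨w, hw, rfl⟩ := hx
  have hs : ∑ j, (∑ v ∈ T, w v • v) j = ∑ v ∈ T, w v :=
    sum_smul_coord (s := T) (v := fun v => v) (fun v hv => (hT v hv).2) w
  rw [hs] at h0 ⊢
  have hpos : 0 < ∑ v ∈ T, w v :=
    lt_of_le_of_ne (Finset.sum_nonneg fun v hv => (hw v hv).le) (Ne.symm h0)
  refine ⟨fun v => (∑ v ∈ T, w v)⁻¹ * w v, fun v hv => mul_pos (inv_pos.2 hpos) (hw v hv), ?_, ?_⟩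
  · rw [← Finset.mul_sum, inv_mul_cancel₀ h0]
  · rw [Finset.smul_sum]
    simp only [mul_smul]

lemma openSimplex_subset_convexHull (T : Finset (Fin (n + 1) → ℝ)) :
    openSimplex T ⊆ convexHull ℝ (T : Set (Fin (n + 1) → ℝ)) := by
  rintro x ⟨w, h1, h2, h3⟩
  exact Finset.mem_convexHull'.2 ⟨w, fun v hv => (h1 v hv).le, h2, h3⟩

/-- A left inverse extends the coordinates on the span to continuous functionals on the whole space,
and their positivity is an open condition. -/
lemma exists_isOpen_openCone {T : Finset (Fin (n + 1) → ℝ)}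
    (hT : LinearIndependent ℝ (Subtype.val : {x // x ∈ T} → Fin (n + 1) → ℝ)) :
    ∃ U, IsOpen U ∧ ∀ x, x ∈ openCone T ↔
      x ∈ U ∧ x ∈ Submodule.span ℝ (T : Set (Fin (n + 1) → ℝ)) := by
  classical
  have hcoe : ∀ w : (Fin (n + 1) → ℝ) → ℝ, ∑ v ∈ T, w v • v = ∑ t : {x // x ∈ T}, w t • t.1 :=
    fun w => (Finset.sum_coe_sort T fun v => w v • v).symm
  let L : ({x // x ∈ T} → ℝ) →ₗ[ℝ] (Fin (n + 1) → ℝ) :=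
    Fintype.linearCombination ℝ (Subtype.val : {x // x ∈ T} → Fin (n + 1) → ℝ)
  have hL : LinearMap.ker L = ⊥ := LinearMap.ker_eq_bot.2
    (linearIndependent_iff_injective_fintypeLinearCombination.1 hT)
  obtain ⟨Φ, hΦ⟩ := L.exists_leftInverse_of_injective hL
  have hΦL : ∀ c, Φ (L c) = c := fun c => LinearMap.congr_fun hΦ c
  have hcont : Continuous Φ := Φ.continuous_of_finiteDimensional
  refine ⟨{x | ∀ t, 0 < Φ x t}, ?_, fun x => ⟨?_, ?_⟩⟩
  · simp only [Set.ofPred_forall]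
    exact isOpen_iInter_of_finite fun t =>
      isOpen_lt continuous_const ((continuous_apply t).comp hcont)
  · rintro ⟨w, hw, rfl⟩
    have h1 : ∑ v ∈ T, w v • v = L fun t => w t := by
      rw [hcoe, Fintype.linearCombination_apply]
    refine ⟨fun t => ?_, Submodule.sum_mem _ fun v hv =>
      Submodule.smul_mem _ _ (Submodule.subset_span hv)⟩
    rw [h1, hΦL]
    exact hw t t.2
  · rintro ⟨hU, hx⟩
    have : x ∈ LinearMap.range L := by
      rw [Fintype.range_linearCombination]
      simpa using hx
    obtain ⟨c, rfl⟩ := this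
    refine ⟨fun v => if h : v ∈ T then c ⟨v, h⟩ else 0, fun v hv => ?_, ?_⟩
    · have := hU ⟨v, hv⟩
      rw [hΦL] at this
      simpa [hv] using this
    · rw [hcoe, Fintype.linearCombination_apply]
      simp

lemma eventually_pos_add_mul {ι : Type*} (s : Finset ι) {w e : ι → ℝ} (hw : ∀ i ∈ s, 0 ≤ w i)
    (he : ∀ i ∈ s, w i = 0 → 0 < e i) : ∀ᶠ ε in 𝓝[>] (0 : ℝ), ∀ i ∈ s, 0 < w i + ε * e i := by
  rw [Finset.eventually_all]
  intro i hi
  rcases (hw i hi).eq_or_lt with h | h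
  · filter_upwards [self_mem_nhdsWithin] with ε hε
    rw [← h, zero_add]
    exact mul_pos hε (he i hi h.symm)
  · refine Filter.Eventually.filter_mono nhdsWithin_le_nhds ?_
    have c1 : Filter.Tendsto (fun ε : ℝ => w i + ε * e i) (𝓝 0) (𝓝 (w i)) :=
      Continuous.tendsto' (by fun_prop) _ _ (by simp)
    exact c1.eventually (lt_mem_nhds h)

/-- An element of the span of a subset as a combination of the set with prescribed vanishing. -/
lemma exists_sum_eq_of_mem_span_filter {E : Type*} [AddCommGroup E] [Module ℝ E] [DecidableEq E]
    {T : Finset E} {q : E → Prop} [DecidablePred q] {x : E}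
    (hx : x ∈ Submodule.span ℝ ((T.filter q : Finset E) : Set E)) :
    ∃ f : E → ℝ, (∀ v ∈ T, ¬ q v → f v = 0) ∧ ∑ v ∈ T, f v • v = x := by
  obtain ⟨f, hf, rfl⟩ := Submodule.mem_span_finset.1 hx
  refine ⟨f, fun v _ hq => ?_, ?_⟩
  · by_contra h
    have := hf (Function.mem_support.2 h)
    simp [hq] at this
  · refine (Finset.sum_subset (Finset.filter_subset _ _) fun v _ hv' => ?_).symm
    have : f v = 0 := by
      by_contra h
      exact hv' (hf (Function.mem_support.2 h))
    rw [this, zero_smul]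

lemma notMem_span_of_coord {V : Set (Fin (n + 1) → ℝ)} {i : Fin (n + 1)}
    (hi : ∀ v ∈ V, v i = 0) {u : Fin (n + 1) → ℝ} (hu : u i ≠ 0) : u ∉ Submodule.span ℝ V := by
  intro h
  have : Submodule.span ℝ V ≤ LinearMap.ker (LinearMap.proj (R := ℝ) (φ := fun _ => ℝ) i) :=
    Submodule.span_le.2 fun v hv => hi v hv
  exact hu (this h)

/-- Let `x` be a common point off `∂Δ`, and let `T'`, `V'` be the vertices with non-zero weight in
its two expressions. Genericity forces `T' ∪ V'` to span everything. This transversality lets `x` be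
moved into both interiors, and gives the dimension of the intersection of the spans. -/
lemma strongGeneralPosition_of_generic {T V : Finset (Fin (n + 1) → ℝ)} {u : Fin (n + 1) → ℝ}
    (hT : IsSimplex T) (hTS : ∀ v ∈ T, v ∈ Simp n)
    (hV : LinearIndependent ℝ (Subtype.val : {x // x ∈ V} → Fin (n + 1) → ℝ))
    (hVS : ∀ v ∈ V, v ∈ Simp n) (hVi : ∃ i, ∀ v ∈ V, v i = 0)
    (hu : u ∈ Simp n) (hupos : ∀ i, 0 < u i)
    (hgen : ∀ T' ⊆ T, ∀ V' ⊆ V,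
      Submodule.span ℝ ((T' : Set (Fin (n + 1) → ℝ)) ∪ V') ≠ ⊤ →
        u ∉ Submodule.span ℝ ((T' : Set (Fin (n + 1) → ℝ)) ∪ V')) :
    StrongGeneralPosition T V u := by
  classical
  obtain ⟨i, hVi⟩ := hVi
  have huV : u ∉ Submodule.span ℝ (V : Set (Fin (n + 1) → ℝ)) :=
    notMem_span_of_coord hVi (hupos i).ne'
  have huV' : u ∉ V := fun h => huV (Submodule.subset_span h)
  have hTl := hT.linearIndependent hTS
  have huVl : LinearIndependent ℝ (Subtype.val : {x // x ∈ insert u V} → Fin (n + 1) → ℝ) := by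
    have h := (LinearIndepOn.insert (s := (V : Set (Fin (n + 1) → ℝ))) (v := id) hV (x := u) (by simpa using huV))
    rw [← Finset.coe_insert] at h
    exact h
  have hIS : ∀ v ∈ insert u V, v ∈ Simp n := by
    intro v hv
    rcases Finset.mem_insert.1 hv with rfl | h
    exacts [hu, hVS v h]
  have hcoe : (insert u V : Set (Fin (n + 1) → ℝ)) = ((insert u V : Finset (Fin (n + 1) → ℝ)) : Set _) :=
    (Finset.coe_insert u V).symm
  unfold StrongGeneralPosition
  rw [hcoe, or_iff_not_imp_left, Set.not_subset]
  rintro ⟨x, ⟨hxT, hxV⟩, hxb⟩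
  have hxS : x ∈ Simp n := convexHull_min hTS (convex_stdSimplex ℝ _) hxT
  have hxi : x i ≠ 0 := fun h => hxb ⟨hxS, i, h⟩
  obtain ⟨w, hw, hw1, hwx⟩ := Finset.mem_convexHull'.1 hxT
  obtain ⟨w', hw', hw1', hwx'⟩ := Finset.mem_convexHull'.1 hxV
  have hwx2 := hwx'
  rw [Finset.sum_insert huV'] at hwx2
  -- All of `V` lies in facet `i` and `x` does not, so the apex must contribute.
  have hwu : w' u ≠ 0 := by
    intro h
    apply hxi
    rw [← hwx2, h]
    simp only [zero_smul, zero_add, Finset.sum_apply, Pi.smul_apply, smul_eq_mul]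
    exact Finset.sum_eq_zero fun v hv => by rw [hVi v hv, mul_zero]
  set T' := T.filter fun v => w v ≠ 0 with hT'
  set V' := V.filter fun v => w' v ≠ 0 with hV'
  have hmemT : x ∈ Submodule.span ℝ (T' : Set (Fin (n + 1) → ℝ)) := by
    rw [← hwx]
    refine Submodule.sum_mem _ fun v hv => ?_
    by_cases h : w v = 0
    · rw [h, zero_smul]; exact Submodule.zero_mem _
    · exact Submodule.smul_mem _ _ (Submodule.subset_span (Finset.mem_filter.2 ⟨hv, h⟩))
  have hmemV : ∑ v ∈ V, w' v • v ∈ Submodule.span ℝ (V' : Set (Fin (n + 1) → ℝ)) := by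
    refine Submodule.sum_mem _ fun v hv => ?_
    by_cases h : w' v = 0
    · rw [h, zero_smul]; exact Submodule.zero_mem _
    · exact Submodule.smul_mem _ _ (Submodule.subset_span (Finset.mem_filter.2 ⟨hv, h⟩))
  -- Solving the two expressions of `x` for `u` puts `u` in this span, which genericity forbids for
  -- a proper subspace.
  have hspan : Submodule.span ℝ ((T' : Set (Fin (n + 1) → ℝ)) ∪ V') = ⊤ := by
    by_contra h
    refine hgen T' (Finset.filter_subset _ _) V' (Finset.filter_subset _ _) h ?_
    rw [Submodule.span_union]
    have h1 : w' u • u = x - ∑ v ∈ V, w' v • v := by rw [← hwx2]; abel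
    have h2 : w' u • u ∈ Submodule.span ℝ (T' : Set (Fin (n + 1) → ℝ)) ⊔
        Submodule.span ℝ (V' : Set (Fin (n + 1) → ℝ)) := by
      rw [h1]
      exact Submodule.sub_mem _ (Submodule.mem_sup_left hmemT) (Submodule.mem_sup_right hmemV)
    exact (Submodule.smul_mem_iff _ hwu).1 h2
  -- a common interior point, by perturbation of `x`
  have hd : (∑ v ∈ T, v) - ∑ v ∈ insert u V, v ∈
      Submodule.span ℝ ((T' : Set (Fin (n + 1) → ℝ)) ∪ V') := by rw [hspan]; trivial
  rw [Submodule.span_union] at hd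
  obtain ⟨p, hp, q, hq, hpq⟩ := Submodule.mem_sup.1 hd
  have hq' : -q ∈ Submodule.span ℝ
      (((insert u V).filter fun v => w' v ≠ 0 : Finset (Fin (n + 1) → ℝ)) : Set (Fin (n + 1) → ℝ)) := by
    refine Submodule.neg_mem _ (Submodule.span_mono ?_ hq)
    exact Finset.coe_subset.2 (Finset.filter_subset_filter _ (Finset.subset_insert _ _))
  obtain ⟨f, hf, hfp⟩ := exists_sum_eq_of_mem_span_filter hp
  obtain ⟨g, hg, hgq⟩ := exists_sum_eq_of_mem_span_filter hq'
  have ev1 := eventually_pos_add_mul T (w := w) (e := fun v => 1 - f v) hw fun v hv h => by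
    simp [hf v hv (by simpa using h)]
  have ev2 := eventually_pos_add_mul (insert u V) (w := w') (e := fun v => 1 - g v) hw'
    fun v hv h => by simp [hg v hv (by simpa using h)]
  obtain ⟨ε, hε1, hε2⟩ := (ev1.and ev2).exists
  -- Because `p + q` is the difference of the two vertex sums, the direction is also the vertex sum
  -- of `u * V` plus `q`. As `p` and `q` involve only vertices of non-zero weight, the direction has
  -- coefficient 1 at every vertex of weight zero, in both expressions, and a small `ε` makes all
  -- weights positive.
  set y := x + ε • ((∑ v ∈ T, v) - p) with hy
  have hyT : y ∈ openCone T := by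
    refine ⟨_, hε1, ?_⟩
    simp only [add_smul, mul_smul, sub_smul, one_smul, Finset.sum_add_distrib, hwx,
      ← Finset.smul_sum, Finset.sum_sub_distrib, hfp, hy]
  have hyV : y ∈ openCone (insert u V) := by
    refine ⟨_, hε2, ?_⟩
    have : (∑ v ∈ T, v) - p = (∑ v ∈ insert u V, v) - (-q) := by
      rw [sub_neg_eq_add, eq_comm, ← sub_eq_zero]
      have := hpq.symm
      rw [← sub_eq_zero] at this
      rw [← neg_eq_zero, ← this]
      abel
    rw [hy, this]
    simp only [add_smul, mul_smul, sub_smul, one_smul, Finset.sum_add_distrib, hwx',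
      ← Finset.smul_sum, Finset.sum_sub_distrib, hgq]
  have hsum : ∀ z ∈ openCone T, ∑ j, z j ≠ 0 := by
    rintro _ ⟨c, hc, rfl⟩
    rw [sum_smul_coord (s := T) (v := fun v => v) (fun v hv => (hTS v hv).2) c]
    exact (Finset.sum_pos hc hT.1).ne'
  obtain ⟨U₁, hU₁, hU₁'⟩ := exists_isOpen_openCone hTl
  obtain ⟨U₂, hU₂, hU₂'⟩ := exists_isOpen_openCone huVl
  set W := Submodule.span ℝ (T : Set (Fin (n + 1) → ℝ)) ⊓
    Submodule.span ℝ ((insert u V : Finset (Fin (n + 1) → ℝ)) : Set (Fin (n + 1) → ℝ)) with hW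
  have hrank : (finrank ℝ W : ℤ) - 1 = simplexDim T + simplexDim V + 1 - n := by
    have h1 := Submodule.finrank_sup_add_finrank_inf_eq
      (Submodule.span ℝ (T : Set (Fin (n + 1) → ℝ)))
      (Submodule.span ℝ ((insert u V : Finset (Fin (n + 1) → ℝ)) : Set (Fin (n + 1) → ℝ)))
    have h2 : Submodule.span ℝ (T : Set (Fin (n + 1) → ℝ)) ⊔
      Submodule.span ℝ ((insert u V : Finset (Fin (n + 1) → ℝ)) : Set (Fin (n + 1) → ℝ)) = ⊤ := by
      rw [eq_top_iff, ← hspan, Submodule.span_union]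
      refine sup_le_sup (Submodule.span_mono ?_) (Submodule.span_mono ?_)
      · exact Finset.coe_subset.2 (Finset.filter_subset _ _)
      · exact Finset.coe_subset.2 ((Finset.filter_subset _ _).trans (Finset.subset_insert _ _))
    rw [h2, finrank_top, finrank_span_of_linearIndependent hTl,
      finrank_span_of_linearIndependent huVl, Finset.card_insert_of_notMem huV'] at h1
    simp only [finrank_fintype_fun_eq_card, Fintype.card_fin] at h1
    unfold simplexDim
    rw [hW]
    omega
  refine ⟨⟨_, openCone_smul_mem hTS hyT (hsum y hyT), openCone_smul_mem hIS hyV (hsum y hyT)⟩, ?_⟩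
  rw [← hrank]
  refine le_antisymm ?_ ?_
  · refine polyDim_le_of_subset_submodules (s := {()}) (W := fun _ => W) ?_ ?_ (by simp)
    · exact fun z hz => convexHull_min hTS (convex_stdSimplex ℝ _) hz.1
    · exact fun z hz => ⟨(), by simp, convexHull_subset_span _ hz.1, convexHull_subset_span _ hz.2⟩
  · refine le_polyDim_of_open (hU₁.inter hU₂) ⟨y, ⟨((hU₁' y).1 hyT).1, ((hU₂' y).1 hyV).1⟩,
      ((hU₁' y).1 hyT).2, ((hU₂' y).1 hyV).2⟩ ?_
    rintro z ⟨hz1, hz2⟩ ⟨hz3, hz4⟩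
    have hzT := (hU₁' z).2 ⟨hz1, hz3⟩
    have hzV := (hU₂' z).2 ⟨hz2, hz4⟩
    exact ⟨_, inv_ne_zero (hsum z hzT),
      openSimplex_subset_convexHull _ (openCone_smul_mem hTS hzT (hsum z hzT)),
      openSimplex_subset_convexHull _ (openCone_smul_mem hIS hzV (hsum z hzT))⟩

/-- The lower bound imposed on the coordinates of the pseudo-barycentres of `n`-simplexes. -/
def centerBound (n : ℕ) : ℝ := 1 / (2 * n + 1)

/-- A point with bounded below coordinates that avoids finitely many proper subspaces. -/
lemma exists_generic_center (hn : n ≠ 0) {𝒲 : Set (Submodule ℝ (Fin (n + 1) → ℝ))}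
    (hfin : 𝒲.Finite) : ∃ u : Simp n, (∀ i, centerBound n ≤ u.1 i) ∧
      ∀ W ∈ 𝒲, W ≠ ⊤ → u.1 ∉ W := by
  have hn' : (0 : ℝ) < n := by exact_mod_cast Nat.pos_of_ne_zero hn
  -- The coordinate bound is made homogeneous, so the point can be chosen in an open cone of `ℝⁿ⁺¹`
  -- and normalized afterwards.
  set U : Set (Fin (n + 1) → ℝ) := {x | ∀ i, 0 < x i ∧ centerBound n * ∑ j, x j < x i} with hU
  have hUo : IsOpen U := by
    simp only [hU, Set.ofPred_forall]
    refine isOpen_iInter_of_finite fun i => ?_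
    exact (isOpen_lt (f := fun _ => (0 : ℝ)) (g := fun x : Fin (n + 1) → ℝ => x i)
      (by fun_prop) (by fun_prop)).inter (isOpen_lt
        (f := fun x : Fin (n + 1) → ℝ => centerBound n * ∑ j, x j)
        (g := fun x : Fin (n + 1) → ℝ => x i) (by fun_prop) (by fun_prop))
  have hne : U.Nonempty := by
    -- The direction of the barycentre; strictness is `n + 1 < 2n + 1`, hence the need for `n ≠ 0`.
    refine ⟨fun _ => 1, fun i => ⟨one_pos, ?_⟩⟩
    simp only [centerBound, Finset.sum_const, Finset.card_univ, Fintype.card_fin, nsmul_eq_mul]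
    rw [mul_one, one_div, inv_mul_lt_iff₀ (by positivity)]
    push_cast
    linarith
  obtain ⟨x, hx, hxW⟩ := exists_mem_forall_notMem_submodule hUo hne
    (hfin.subset (Set.sep_subset 𝒲 fun W => W ≠ ⊤)) fun W hW => hW.2
  have hs : 0 < ∑ j, x j := Finset.sum_pos (fun j _ => (hx j).1) Finset.univ_nonempty
  refine ⟨⟨(∑ j, x j)⁻¹ • x, fun i => ?_, ?_⟩, fun i => ?_, fun W hW hWt hmem => ?_⟩
  · exact mul_nonneg (inv_nonneg.2 hs.le) (hx i).1.le
  · simp only [Pi.smul_apply, smul_eq_mul, ← Finset.mul_sum]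
    exact inv_mul_cancel₀ hs.ne'
  · change _ ≤ (∑ j, x j)⁻¹ * x i
    rw [le_inv_mul_iff₀ hs, mul_comm]
    exact (hx i).2.le
  · exact hxW W ⟨hW, hWt⟩ ((Submodule.smul_mem_iff _ (inv_ne_zero hs.ne')).1 hmem)

end GeneralPosition

/-! ### Facet inclusions -/

section Facet

variable {n : ℕ}

@[simp] lemma facetIncl_same (i : Fin (n + 2)) (x : Fin (n + 1) → ℝ) : facetIncl i x i = 0 := by
  simp [facetIncl]

@[simp] lemma facetIncl_succAbove (i : Fin (n + 2)) (x : Fin (n + 1) → ℝ) (k : Fin (n + 1)) :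
    facetIncl i x (i.succAbove k) = x k := by
  simp [facetIncl]

lemma facetIncl_injective (i : Fin (n + 2)) : Function.Injective (facetIncl (n := n) i) :=
  fun x y h => funext fun k => by simpa using congrFun h (i.succAbove k)

lemma facetIncl_sum_smul (i : Fin (n + 2)) {ι : Type*} (s : Finset ι) (w : ι → ℝ)
    (v : ι → Fin (n + 1) → ℝ) :
    facetIncl i (∑ t ∈ s, w t • v t) = ∑ t ∈ s, w t • facetIncl i (v t) := by
  funext j
  refine Fin.succAboveCases i ?_ (fun k => ?_) j
  · simp [Finset.sum_apply]
  · simp [Finset.sum_apply]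

/-- The cosimplicial identity, in a form that treats both orders of the two facets at once. -/
lemma facetIncl_facetIncl (j : Fin (n + 3)) (i : Fin (n + 2)) (x : Fin (n + 1) → ℝ) :
    facetIncl (j.succAbove i) (facetIncl (i.predAbove j) x) = facetIncl j (facetIncl i x) := by
  funext c
  refine Fin.succAboveCases j ?_ (fun d => ?_) c
  · rw [facetIncl_same]
    have h := facetIncl_succAbove (j.succAbove i) (facetIncl (i.predAbove j) x) (i.predAbove j)
    rw [Fin.succAbove_succAbove_predAbove] at h
    rw [h, facetIncl_same]
  · rw [facetIncl_succAbove]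
    refine Fin.succAboveCases i ?_ (fun k => ?_) d
    · simp
    · rw [facetIncl_succAbove, ← Fin.succAbove_succAbove_succAbove_predAbove, facetIncl_succAbove,
        facetIncl_succAbove]

lemma coface_coface (j : Fin (n + 3)) (i : Fin (n + 2)) (x : Simp n) :
    coface (j.succAbove i) (coface (i.predAbove j) x) = coface j (coface i x) :=
  Subtype.ext (facetIncl_facetIncl j i x.1)

lemma face_face {X : Type*} [TopologicalSpace X] (j : Fin (n + 3)) (i : Fin (n + 2))
    (σ : Sing X (n + 2)) :
    face (i.predAbove j) (face (j.succAbove i) σ) = face i (face j σ) :=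
  ContinuousMap.ext fun x => congrArg σ (coface_coface j i x)

lemma exists_facetIncl_eq {x : Fin (n + 2) → ℝ} (hx : x ∈ Simp (n + 1)) {i : Fin (n + 2)}
    (hi : x i = 0) : ∃ y ∈ Simp n, facetIncl i y = x := by
  refine ⟨fun k => x (i.succAbove k), ⟨fun k => hx.1 _, ?_⟩, ?_⟩
  · have := hx.2
    rw [Fin.sum_univ_succAbove _ i, hi, zero_add] at this
    exact this
  · funext j
    refine Fin.succAboveCases i ?_ (fun k => ?_) j
    · simp [hi]
    · simp

lemma facetIncl_mem_convexHull (i : Fin (n + 2)) {s : Finset (Fin (n + 1) → ℝ)}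
    {x : Fin (n + 1) → ℝ} (hx : x ∈ convexHull ℝ (s : Set (Fin (n + 1) → ℝ))) :
    facetIncl i x ∈ convexHull ℝ ((s.image (facetIncl i) : Finset _) : Set (Fin (n + 2) → ℝ)) := by
  obtain ⟨w, h0, h1, rfl⟩ := Finset.mem_convexHull'.1 hx
  rw [facetIncl_sum_smul]
  exact (convex_convexHull ℝ _).sum_mem h0 h1 fun v hv =>
    subset_convexHull ℝ _ (Finset.mem_coe.2 (Finset.mem_image_of_mem _ hv))

end Facet

/-! ### Triangulations by unique nonnegative coordinates -/

section Triangulation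

variable {n : ℕ}

/-- Every vector has at most one expression as a nonnegative combination of the vertices of a
member of the family. -/
def UniqueWeights {E : Type*} [AddCommGroup E] [Module ℝ E] (K : Set (Finset E)) : Prop :=
  ∀ s ∈ K, ∀ t ∈ K, ∀ w w' : E → ℝ, (∀ v, 0 ≤ w v) → (∀ v, 0 ≤ w' v) → (∀ v ∉ s, w v = 0) →
    (∀ v ∉ t, w' v = 0) → ∑ v ∈ s, w v • v = ∑ v ∈ t, w' v • v → w = w'

/-- A finite triangulation of the standard simplex, each of whose simplexes stays away from some
facet. -/
structure IsTriangulation (K : Set (Finset (Fin (n + 1) → ℝ))) : Prop where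
  finite : K.Finite
  nonempty : ∀ s ∈ K, s.Nonempty
  subset_simp : ∀ s ∈ K, ∀ v ∈ s, v ∈ Simp n
  down_closed : ∀ s ∈ K, ∀ t ⊆ s, t.Nonempty → t ∈ K
  unique : UniqueWeights K
  covers : ∀ x ∈ Simp n, ∃ s ∈ K, x ∈ convexHull ℝ (s : Set (Fin (n + 1) → ℝ))
  common : ∀ s ∈ K, ∃ e, ∀ v ∈ s, centerBound n ≤ v e

/-- The positive and negative parts of a relation are two nonnegative expressions of the same
vector, so they coincide and vanish. -/
lemma UniqueWeights.linearIndependent {E : Type*} [AddCommGroup E] [Module ℝ E]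
    {K : Set (Finset E)} (hK : UniqueWeights K) {s : Finset E} (hs : s ∈ K) :
    LinearIndependent ℝ (Subtype.val : {x // x ∈ s} → E) := by
  classical
  rw [Fintype.linearIndependent_iff]
  intro g hg
  have hsum : ∀ c : {x // x ∈ s} → ℝ,
      ∑ v ∈ s, (if h : v ∈ s then c ⟨v, h⟩ else 0) • v = ∑ i, c i • i.1 := fun c => by
    rw [← Finset.sum_coe_sort s]
    exact Finset.sum_congr rfl fun i _ => by simp
  have := hK s hs s hs (fun v => if h : v ∈ s then max (g ⟨v, h⟩) 0 else 0)
    (fun v => if h : v ∈ s then max (-g ⟨v, h⟩) 0 else 0)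
    (fun v => by split_ifs <;> simp) (fun v => by split_ifs <;> simp)
    (fun v hv => by simp [hv]) (fun v hv => by simp [hv]) (by
      rw [hsum fun i => max (g i) 0, hsum fun i => max (-g i) 0, ← sub_eq_zero,
        ← Finset.sum_sub_distrib, ← hg]
      refine Finset.sum_congr rfl fun i _ => ?_
      rw [← sub_smul]
      congr 1
      rcases le_total (g i) 0 with h | h
      · rw [max_eq_right h, max_eq_left (by linarith)]; ring
      · rw [max_eq_left h, max_eq_right (by linarith)]; ring)
  intro i
  have h := congrFun this i.1
  simp only [i.2, dif_pos] at h
  rcases le_total (g i) 0 with h' | h'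
  · rw [max_eq_right h', max_eq_left (by linarith)] at h; linarith
  · rw [max_eq_left h', max_eq_right (by linarith)] at h; linarith

/-- The two families of barycentric weights of a common point agree, hence are supported on the
common vertices. -/
lemma UniqueWeights.inter_subset {E : Type*} [AddCommGroup E] [Module ℝ E]
    {K : Set (Finset E)} (hK : UniqueWeights K) {s t : Finset E} (hs : s ∈ K) (ht : t ∈ K) :
    convexHull ℝ (s : Set E) ∩ convexHull ℝ (t : Set E) ⊆ convexHull ℝ (s ∩ t : Set E) := by
  classical
  rintro x ⟨hxs, hxt⟩
  obtain ⟨w, h0, h1, hw⟩ := Finset.mem_convexHull'.1 hxs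
  obtain ⟨w', h0', h1', hw'⟩ := Finset.mem_convexHull'.1 hxt
  have key := hK s hs t ht (fun v => if v ∈ s then w v else 0) (fun v => if v ∈ t then w' v else 0)
    (fun v => by split_ifs with h; exacts [h0 v h, le_rfl])
    (fun v => by split_ifs with h; exacts [h0' v h, le_rfl])
    (fun v hv => by simp [hv]) (fun v hv => by simp [hv]) (by
      rw [Finset.sum_congr rfl fun v hv => by rw [if_pos hv], hw,
        Finset.sum_congr rfl fun v hv => by rw [if_pos hv], hw'])
  have hz : ∀ v ∈ s, v ∉ s ∩ t → w v = 0 := fun v hv hvt => by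
    have h := congrFun key v
    have : v ∉ t := fun h' => hvt (Finset.mem_inter.2 ⟨hv, h'⟩)
    simpa [hv, this] using h
  rw [← Finset.coe_inter]
  refine Finset.mem_convexHull'.2 ⟨w, fun v hv => h0 v (Finset.mem_inter.1 hv).1, ?_, ?_⟩
  · rw [Finset.sum_subset Finset.inter_subset_left hz, h1]
  · rw [Finset.sum_subset Finset.inter_subset_left fun v hv hvt => by rw [hz v hv hvt, zero_smul], hw]

/-- The simplicial complex given by a triangulation. -/
def IsTriangulation.complex {K : Set (Finset (Fin (n + 1) → ℝ))} (hK : IsTriangulation K) :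
    Geometry.SimplicialComplex ℝ (Fin (n + 1) → ℝ) where
  faces := K
  isRelLowerSet_faces := fun s hs => ⟨hK.nonempty s hs, fun t hts ht => hK.down_closed s hs t hts ht⟩
  indep := fun hs => (hK.unique.linearIndependent hs).affineIndependent
  inter_subset_convexHull := fun hs ht => hK.unique.inter_subset hs ht

lemma IsTriangulation.space_complex {K : Set (Finset (Fin (n + 1) → ℝ))} (hK : IsTriangulation K) :
    hK.complex.space = Simp n := by
  ext x
  rw [Geometry.SimplicialComplex.mem_space_iff]
  refine ⟨?_, hK.covers x⟩
  rintro ⟨s, hs, hx⟩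
  exact convexHull_min (hK.subset_simp s hs) (convex_stdSimplex ℝ _) hx

/-- Coordinate `e` ranges in `[c, 1]`, which leaves at most `1 - c` for any other coordinate. -/
lemma abs_sub_le_of_common {c : ℝ} {x y : Fin (n + 1) → ℝ} (hx : x ∈ Simp n) (hy : y ∈ Simp n)
    {e : Fin (n + 1)} (hxe : c ≤ x e) (hye : c ≤ y e) (i : Fin (n + 1)) : |x i - y i| ≤ 1 - c := by
  have key : ∀ z ∈ Simp n, ∀ k, z k ≤ 1 := fun z hz k => by
    rw [← hz.2]
    exact Finset.single_le_sum (fun j _ => hz.1 j) (Finset.mem_univ k)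
  have key2 : ∀ z ∈ Simp n, ∀ k ≠ e, z k + z e ≤ 1 := fun z hz k hk => by
    rw [← hz.2, ← Finset.sum_pair hk]
    exact Finset.sum_le_sum_of_subset_of_nonneg (Finset.subset_univ _) fun j _ _ => hz.1 j
  rw [abs_le]
  by_cases hi : i = e
  · subst hi
    have := key x hx i
    have := key y hy i
    constructor <;> linarith
  · have := key2 x hx i hi
    have := key2 y hy i hi
    have := hx.1 i
    have := hy.1 i
    constructor <;> linarith

lemma IsTriangulation.diam_le {K : Set (Finset (Fin (n + 1) → ℝ))} (hK : IsTriangulation K)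
    {s : Finset (Fin (n + 1) → ℝ)} (hs : s ∈ K) :
    Metric.diam (convexHull ℝ (s : Set (Fin (n + 1) → ℝ))) ≤ 2 * (n : ℝ) / (2 * n + 1) := by
  obtain ⟨e, he⟩ := hK.common s hs
  rw [convexHull_diam]
  refine Metric.diam_le_of_forall_dist_le (by positivity) fun x hx y hy => ?_
  refine (dist_pi_le_iff (by positivity)).2 fun i => ?_
  rw [Real.dist_eq]
  refine (abs_sub_le_of_common (hK.subset_simp s hs x hx) (hK.subset_simp s hs y hy)
    (he x hx) (he y hy) i).trans (le_of_eq ?_)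
  unfold centerBound
  field_simp
  ring

/-- The transport to the `i`-th facet of a family of simplexes. -/
def facetImage (i : Fin (n + 2)) (K : Set (Finset (Fin (n + 1) → ℝ))) :
    Set (Finset (Fin (n + 2) → ℝ)) :=
  (fun s => s.image (facetIncl i)) '' K

/-- The cone with apex `u` on a family of simplexes. -/
def coneFaces (u : Fin (n + 1) → ℝ) (L : Set (Finset (Fin (n + 1) → ℝ))) :
    Set (Finset (Fin (n + 1) → ℝ)) :=
  L ∪ {{u}} ∪ (fun s => insert u s) '' L

lemma facetImage_coord {i : Fin (n + 2)} {K : Set (Finset (Fin (n + 1) → ℝ))}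
    {s : Finset (Fin (n + 2) → ℝ)} (hs : s ∈ facetImage i K) : ∀ v ∈ s, v i = 0 := by
  obtain ⟨s, -, rfl⟩ := hs
  intro v hv
  obtain ⟨y, -, rfl⟩ := Finset.mem_image.1 hv
  exact facetIncl_same i y

lemma weights_eq_zero_of_sum_eq_zero {s : Finset (Fin (n + 1) → ℝ)} (hs : ∀ v ∈ s, v ∈ Simp n)
    {w : (Fin (n + 1) → ℝ) → ℝ} (h0 : ∀ v, 0 ≤ w v) (hw : ∀ v ∉ s, w v = 0)
    (h : ∑ v ∈ s, w v • v = 0) : w = 0 := by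
  have h1 := sum_smul_coord (s := s) (v := fun v => v) (fun v hv => (hs v hv).2) w
  rw [h] at h1
  simp only [Pi.zero_apply, Finset.sum_const_zero] at h1
  funext v
  by_cases hv : v ∈ s
  · exact (Finset.sum_eq_zero_iff_of_nonneg fun v _ => h0 v).1 h1.symm v hv
  · exact hw v hv

variable {K : Fin (n + 2) → Set (Finset (Fin (n + 1) → ℝ))}

/-- A vector expressed by `s` in facet `i` and by `t` in facet `j` has zero `j`-th coordinate, so
only the vertices of `s` in facet `j` carry weight. By compatibility they form a simplex of the
triangulation of facet `j`, where uniqueness is known. The empty simplex is included so that the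
apex alone counts as a cone. -/
lemma uniqueWeights_boundary (hK : ∀ i, IsTriangulation (K i))
    (hcompat : ∀ i j, ∀ s ∈ facetImage i (K i), (∀ v ∈ s, v j = 0) → s ∈ facetImage j (K j)) :
    UniqueWeights (insert ∅ (⋃ i, facetImage i (K i))) := by
  classical
  have hS : ∀ s ∈ insert ∅ (⋃ i, facetImage i (K i)), ∀ v ∈ s, v ∈ Simp (n + 1) := by
    rintro s (rfl | hs) v hv
    · simp at hv
    · obtain ⟨i, s0, hs0, rfl⟩ := Set.mem_iUnion.1 hs
      obtain ⟨y, hy, rfl⟩ := Finset.mem_image.1 hv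
      exact facetIncl_mem i ((hK i).subset_simp s0 hs0 y hy)
  intro s hs t ht w w' hw hw' hws hwt heq
  have zs : ∑ v ∈ s, w v • v = 0 → w = w' := fun h => by
    rw [weights_eq_zero_of_sum_eq_zero (hS s hs) hw hws h,
      weights_eq_zero_of_sum_eq_zero (hS t ht) hw' hwt (heq ▸ h)]
  rcases id hs with rfl | hs'
  · exact zs (by simp)
  rcases id ht with rfl | ht'
  · exact zs (by rw [heq]; simp)
  obtain ⟨i, hsi⟩ := Set.mem_iUnion.1 hs'
  obtain ⟨j, htj⟩ := Set.mem_iUnion.1 ht'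
  have hvj : ∀ v ∈ s, v j ≠ 0 → w v = 0 := by
    have h1 : ∑ v ∈ s, w v * v j = 0 := by
      have := congrFun heq j
      simp only [Finset.sum_apply, Pi.smul_apply, smul_eq_mul] at this
      rw [this]
      exact Finset.sum_eq_zero fun v hv => by rw [facetImage_coord htj v hv, mul_zero]
    intro v hv hvj
    have := (Finset.sum_eq_zero_iff_of_nonneg
      fun v hv => mul_nonneg (hw v) ((hS s hs v hv).1 j)).1 h1 v hv
    exact (mul_eq_zero.1 this).resolve_right hvj
  set s' := s.filter fun v => v j = 0 with hs'
  have hsum : ∑ v ∈ s', w v • v = ∑ v ∈ s, w v • v :=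
    Finset.sum_subset (Finset.filter_subset _ _) fun v hv hv' => by
      rw [hvj v hv fun h => hv' (Finset.mem_filter.2 ⟨hv, h⟩), zero_smul]
  have hws' : ∀ v ∉ s', w v = 0 := fun v hv => by
    by_cases h : v ∈ s
    · exact hvj v h fun h' => hv (Finset.mem_filter.2 ⟨h, h'⟩)
    · exact hws v h
  rcases s'.eq_empty_or_nonempty with he | hne
  · exact zs (by rw [← hsum, he]; simp)
  have hs'i : s' ∈ facetImage i (K i) := by
    obtain ⟨s0, hs0, rfl⟩ := hsi
    refine ⟨s0.filter fun y => facetIncl i y j = 0, (hK i).down_closed s0 hs0 _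
      (Finset.filter_subset _ _) ?_, ?_⟩
    · obtain ⟨v, hv⟩ := hne
      obtain ⟨hv1, hv2⟩ := Finset.mem_filter.1 hv
      obtain ⟨y, hy, rfl⟩ := Finset.mem_image.1 hv1
      exact ⟨y, Finset.mem_filter.2 ⟨hy, hv2⟩⟩
    · rw [hs', Finset.filter_image]
  obtain ⟨s0, hs0, hs0e⟩ := hcompat i j s' hs'i fun v hv => (Finset.mem_filter.1 hv).2
  obtain ⟨t0, ht0, rfl⟩ := htj
  simp only at hs0e
  have himg : ∀ (r : Finset (Fin (n + 1) → ℝ)) (c : (Fin (n + 2) → ℝ) → ℝ),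
      ∑ v ∈ r.image (facetIncl j), c v • v =
        facetIncl j (∑ y ∈ r, c (facetIncl j y) • y) := fun r c => by
    rw [Finset.sum_image (facetIncl_injective j).injOn, facetIncl_sum_smul]
  rw [← hsum, ← hs0e, himg, himg] at heq
  have hnot : ∀ (r : Finset (Fin (n + 1) → ℝ)) y, y ∉ r → facetIncl j y ∉ r.image (facetIncl j) :=
    fun r y hy h => hy ((facetIncl_injective j).mem_finset_image.1 h)
  have key := (hK j).unique s0 hs0 t0 ht0 (fun y => w (facetIncl j y)) (fun y => w' (facetIncl j y))
    (fun y => hw _) (fun y => hw' _) (fun y hy => hws' _ (hs0e ▸ hnot s0 y hy))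
    (fun y hy => hwt _ (hnot t0 y hy)) (facetIncl_injective j heq)
  funext v
  by_cases hv : ∃ y, facetIncl j y = v
  · obtain ⟨y, rfl⟩ := hv
    exact congrFun key y
  · have hr : ∀ r : Finset (Fin (n + 1) → ℝ), v ∉ r.image (facetIncl j) := fun r h => by
      obtain ⟨y, -, hy⟩ := Finset.mem_image.1 h
      exact hv ⟨y, hy⟩
    rw [hws' v (hs0e ▸ hr s0), hwt v (hr t0)]

/-- On a coordinate `i` vanishing on the base `s`, the vector equals `w u * u i`, while any other
expression contributes at least `w' u * u i`. By symmetry the apex weights agree; they cancel, and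
uniqueness on the base applies. -/
lemma uniqueWeights_cone {L : Set (Finset (Fin (n + 1) → ℝ))} (hL : UniqueWeights (insert ∅ L))
    (hLS : ∀ s ∈ L, ∀ v ∈ s, v ∈ Simp n) (hLi : ∀ s ∈ L, ∃ i, ∀ v ∈ s, v i = 0)
    {u : Fin (n + 1) → ℝ} (hu : ∀ i, 0 < u i) : UniqueWeights (coneFaces u L) := by
  classical
  have huL : ∀ s ∈ insert ∅ L, u ∉ s := by
    rintro s (rfl | hs) h
    · simp at h
    · obtain ⟨i, hi⟩ := hLi s hs
      exact (hu i).ne' (hi u h)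
  have hbase : ∀ s ∈ coneFaces u L, ∃ r ∈ insert ∅ L, s ⊆ insert u r := by
    rintro s ((hs | rfl) | ⟨s, hs, rfl⟩)
    · exact ⟨s, Or.inr hs, Finset.subset_insert _ _⟩
    · exact ⟨∅, Or.inl rfl, by simp⟩
    · exact ⟨s, Or.inr hs, le_rfl⟩
  have hsplit : ∀ s r : Finset (Fin (n + 1) → ℝ), ∀ w : (Fin (n + 1) → ℝ) → ℝ, r ∈ insert ∅ L →
      s ⊆ insert u r → (∀ v ∉ s, w v = 0) →
      ∑ v ∈ s, w v • v = w u • u + ∑ v ∈ r, w v • v := fun s r w hr hsr hw => by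
    rw [← Finset.sum_insert (f := fun v => w v • v) (huL r hr)]
    exact Finset.sum_subset hsr fun v _ hv => by rw [hw v hv, zero_smul]
  have hle : ∀ s r : Finset (Fin (n + 1) → ℝ), ∀ w w' : (Fin (n + 1) → ℝ) → ℝ, s ∈ insert ∅ L →
      r ∈ insert ∅ L → (∀ v, 0 ≤ w' v) →
      w u • u + ∑ v ∈ s, w v • v = w' u • u + ∑ v ∈ r, w' v • v → w' u ≤ w u := by
    intro s r w w' hs hr hw' heq
    obtain ⟨i, hi⟩ : ∃ i, ∀ v ∈ s, v i = 0 := by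
      rcases hs with rfl | hs
      · exact ⟨0, by simp⟩
      · exact hLi s hs
    have h := congrFun heq i
    simp only [Pi.add_apply, Pi.smul_apply, Finset.sum_apply, smul_eq_mul] at h
    rw [Finset.sum_eq_zero (s := s) fun v hv => by rw [hi v hv, mul_zero], add_zero] at h
    have h2 : 0 ≤ ∑ v ∈ r, w' v * v i := by
      refine Finset.sum_nonneg fun v hv => mul_nonneg (hw' v) ?_
      rcases hr with rfl | hr
      · simp at hv
      · exact (hLS r hr v hv).1 i
    exact le_of_mul_le_mul_right (by linarith) (hu i)
  intro s hs t ht w w' hw hw' hws hwt heq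
  obtain ⟨s0, hs0, hss⟩ := hbase s hs
  obtain ⟨t0, ht0, htt⟩ := hbase t ht
  rw [hsplit s s0 w hs0 hss hws, hsplit t t0 w' ht0 htt hwt] at heq
  have hwu : w u = w' u := le_antisymm (hle t0 s0 w' w ht0 hs0 hw heq.symm)
    (hle s0 t0 w w' hs0 ht0 hw' heq)
  rw [hwu] at heq
  have heq := add_left_cancel heq
  have hupd : ∀ (r : Finset (Fin (n + 1) → ℝ)) (c : (Fin (n + 1) → ℝ) → ℝ), u ∉ r →
      ∑ v ∈ r, Function.update c u 0 v • v = ∑ v ∈ r, c v • v := fun r c hr =>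
    Finset.sum_congr rfl fun v hv => by
      rw [Function.update_of_ne fun h => hr (by rwa [← h])]
  have hupd0 : ∀ c : (Fin (n + 1) → ℝ) → ℝ, (∀ v, 0 ≤ c v) → ∀ v, 0 ≤ Function.update c u 0 v :=
    fun c hc v => by
      by_cases h : v = u
      · rw [h, Function.update_self]
      · rw [Function.update_of_ne h]; exact hc v
  have hupdz : ∀ (s r : Finset (Fin (n + 1) → ℝ)) (c : (Fin (n + 1) → ℝ) → ℝ), s ⊆ insert u r →
      (∀ v ∉ s, c v = 0) → ∀ v ∉ r, Function.update c u 0 v = 0 := fun s r c hsr hc v hv => by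
    by_cases h : v = u
    · rw [h, Function.update_self]
    · rw [Function.update_of_ne h]
      refine hc v fun hvs => ?_
      exact (Finset.mem_insert.1 (hsr hvs)).elim h hv
  have key := hL s0 hs0 t0 ht0 (Function.update w u 0) (Function.update w' u 0) (hupd0 w hw)
    (hupd0 w' hw') (hupdz s s0 w hss hws) (hupdz t t0 w' htt hwt)
    (by rw [hupd _ _ (huL s0 hs0), hupd _ _ (huL t0 ht0), heq])
  funext v
  by_cases h : v = u
  · rw [h, hwu]
  · simpa [Function.update_of_ne h] using congrFun key v

/-- Radial projection from `u`: the largest multiple `a • u` below `x` is subtracted, with `a` the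
least ratio `x i / u i`, so that one coordinate vanishes. -/
lemma exists_cone_decomposition {u x : Fin (n + 1) → ℝ} (hu : u ∈ Simp n) (hupos : ∀ i, 0 < u i)
    (hx : x ∈ Simp n) (hxu : x ≠ u) :
    ∃ a : ℝ, 0 ≤ a ∧ a ≤ 1 ∧ ∃ z ∈ bdry n, x = a • u + (1 - a) • z := by
  obtain ⟨i, -, hi⟩ := Finset.exists_min_image Finset.univ (fun i => x i / u i) Finset.univ_nonempty
  set a := x i / u i with ha
  have hle : ∀ j, a * u j ≤ x j := fun j => (le_div_iff₀ (hupos j)).1 (hi j (Finset.mem_univ j))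
  have ha0 : 0 ≤ a := div_nonneg (hx.1 i) (hupos i).le
  have ha1 : a ≤ 1 := by
    have := Finset.sum_le_sum fun j (_ : j ∈ Finset.univ) => hle j
    rwa [← Finset.mul_sum, hu.2, hx.2, mul_one] at this
  have hane : a ≠ 1 := fun h => hxu <| by
    have hle' : ∀ j ∈ Finset.univ, u j ≤ x j := fun j _ => by simpa [h] using hle j
    have := (Finset.sum_eq_sum_iff_of_le hle').1 (by rw [hu.2, hx.2])
    exact funext fun j => (this j (Finset.mem_univ j)).symm
  have hpos : 0 < 1 - a := sub_pos.2 (lt_of_le_of_ne ha1 hane)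
  refine ⟨a, ha0, ha1, (1 - a)⁻¹ • (x - a • u), ⟨⟨fun j => ?_, ?_⟩, i, ?_⟩, ?_⟩
  · exact mul_nonneg (inv_nonneg.2 hpos.le) (sub_nonneg.2 (hle j))
  · simp only [Pi.smul_apply, Pi.sub_apply, smul_eq_mul]
    rw [← Finset.mul_sum, Finset.sum_sub_distrib, ← Finset.mul_sum, hu.2, hx.2, mul_one,
      inv_mul_cancel₀ hpos.ne']
  · simp only [Pi.smul_apply, Pi.sub_apply, smul_eq_mul, ha]
    rw [div_mul_cancel₀ _ (hupos i).ne', sub_self, mul_zero]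
  · rw [smul_smul, mul_inv_cancel₀ hpos.ne', one_smul, add_sub_cancel]

lemma centerBound_pos (n : ℕ) : 0 < centerBound n := by
  unfold centerBound
  positivity

lemma centerBound_succ_le (n : ℕ) : centerBound (n + 1) ≤ centerBound n := by
  unfold centerBound
  push_cast
  exact one_div_le_one_div_of_le (by positivity) (by linarith)

lemma isTriangulation_cone (hK : ∀ i, IsTriangulation (K i))
    (hcompat : ∀ i j, ∀ s ∈ facetImage i (K i), (∀ v ∈ s, v j = 0) → s ∈ facetImage j (K j))
    {u : Fin (n + 2) → ℝ} (hu : u ∈ Simp (n + 1)) (hub : ∀ i, centerBound (n + 1) ≤ u i) :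
    IsTriangulation (coneFaces u (⋃ i, facetImage i (K i))) := by
  classical
  have hupos : ∀ i, 0 < u i := fun i => (centerBound_pos _).trans_le (hub i)
  have hLS : ∀ s ∈ ⋃ i, facetImage i (K i), ∀ v ∈ s, v ∈ Simp (n + 1) := by
    intro s hs v hv
    obtain ⟨i, s0, hs0, rfl⟩ := Set.mem_iUnion.1 hs
    obtain ⟨y, hy, rfl⟩ := Finset.mem_image.1 hv
    exact facetIncl_mem i ((hK i).subset_simp s0 hs0 y hy)
  have hLi : ∀ s ∈ ⋃ i, facetImage i (K i), ∃ i, ∀ v ∈ s, v i = 0 := by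
    intro s hs
    obtain ⟨i, hs⟩ := Set.mem_iUnion.1 hs
    exact ⟨i, facetImage_coord hs⟩
  have hLfin : (⋃ i, facetImage i (K i)).Finite :=
    Set.finite_iUnion fun i => (hK i).finite.image _
  have hLdown : ∀ s ∈ ⋃ i, facetImage i (K i), ∀ t ⊆ s, t.Nonempty → t ∈ ⋃ i, facetImage i (K i) := by
    intro s hs t hts ht
    obtain ⟨i, s0, hs0, rfl⟩ := Set.mem_iUnion.1 hs
    obtain ⟨t0, ht0, rfl⟩ := Finset.subset_image_iff.1 hts
    exact Set.mem_iUnion.2 ⟨i, t0, (hK i).down_closed s0 hs0 t0 (by exact_mod_cast ht0)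
      (Finset.image_nonempty.1 ht), rfl⟩
  -- The large coordinate of a simplex persists in the facet inclusion, since `centerBound`
  -- decreases with dimension; the cone keeps it because every coordinate of `u` is large.
  have hLcommon : ∀ s ∈ ⋃ i, facetImage i (K i), ∃ e, ∀ v ∈ s, centerBound (n + 1) ≤ v e := by
    intro s hs
    obtain ⟨i, s0, hs0, rfl⟩ := Set.mem_iUnion.1 hs
    obtain ⟨e, he⟩ := (hK i).common s0 hs0
    refine ⟨i.succAbove e, fun v hv => ?_⟩
    obtain ⟨y, hy, rfl⟩ := Finset.mem_image.1 hv
    rw [facetIncl_succAbove]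
    exact (centerBound_succ_le n).trans (he y hy)
  have hLcov : ∀ x ∈ bdry (n + 1), ∃ s ∈ ⋃ i, facetImage i (K i),
      x ∈ convexHull ℝ (s : Set (Fin (n + 2) → ℝ)) := by
    rintro x ⟨hx, i, hi⟩
    obtain ⟨y, hy, rfl⟩ := exists_facetIncl_eq hx hi
    obtain ⟨s, hs, hys⟩ := (hK i).covers y hy
    exact ⟨_, Set.mem_iUnion.2 ⟨i, s, hs, rfl⟩, facetIncl_mem_convexHull i hys⟩
  refine ⟨(hLfin.union (Set.finite_singleton _)).union (hLfin.image _), ?_, ?_, ?_,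
    uniqueWeights_cone (uniqueWeights_boundary hK hcompat) hLS hLi hupos, ?_, ?_⟩
  · rintro s ((hs | rfl) | ⟨s, hs, rfl⟩)
    · obtain ⟨i, s0, hs0, rfl⟩ := Set.mem_iUnion.1 hs
      exact ((hK i).nonempty s0 hs0).image _
    · exact Finset.singleton_nonempty u
    · exact Finset.insert_nonempty u s
  · rintro s ((hs | rfl) | ⟨s, hs, rfl⟩) v hv
    · exact hLS s hs v hv
    · rw [Finset.mem_singleton.1 hv]; exact hu
    · rcases Finset.mem_insert.1 hv with rfl | hv
      exacts [hu, hLS s hs v hv]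
  · have hins : ∀ s, (s ∈ ⋃ i, facetImage i (K i)) → ∀ t ⊆ insert u s, t.Nonempty →
        t ∈ coneFaces u (⋃ i, facetImage i (K i)) := by
      intro s hs t hts ht
      by_cases hut : u ∈ t
      · have hte : t.erase u ⊆ s := Finset.subset_insert_iff.1 hts
        rcases (t.erase u).eq_empty_or_nonempty with h | h
        · refine Or.inl (Or.inr ?_)
          rw [Set.mem_singleton_iff, ← Finset.insert_erase hut, h]
          rfl
        · exact Or.inr ⟨t.erase u, hLdown s hs _ hte h, Finset.insert_erase hut⟩
      · exact Or.inl (Or.inl (hLdown s hs t ((Finset.subset_insert_iff_of_notMem hut).1 hts) ht))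
    rintro s ((hs | rfl) | ⟨s, hs, rfl⟩) t hts ht
    · exact hins s hs t (hts.trans (Finset.subset_insert _ _)) ht
    · rcases Finset.subset_singleton_iff.1 hts with rfl | rfl
      · simp at ht
      · exact Or.inl (Or.inr rfl)
    · exact hins s hs t hts ht
  · intro x hx
    by_cases hxu : x = u
    · exact ⟨{u}, Or.inl (Or.inr rfl), by simp [hxu]⟩
    obtain ⟨a, ha0, ha1, z, hz, rfl⟩ := exists_cone_decomposition hu hupos hx hxu
    obtain ⟨s, hs, hzs⟩ := hLcov z hz
    refine ⟨insert u s, Or.inr ⟨s, hs, rfl⟩, ?_⟩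
    refine (convex_convexHull ℝ _) (subset_convexHull ℝ _ (by simp))
      (convexHull_mono (by simp) hzs) ha0 (by linarith) (by ring)
  · rintro s ((hs | rfl) | ⟨s, hs, rfl⟩)
    · exact hLcommon s hs
    · exact ⟨0, fun v hv => by rw [Finset.mem_singleton.1 hv]; exact hub 0⟩
    · obtain ⟨e, he⟩ := hLcommon s hs
      refine ⟨e, fun v hv => ?_⟩
      rcases Finset.mem_insert.1 hv with rfl | hv
      exacts [hub e, he v hv]

/-- The faces of the cone that lie in a facet. -/
lemma coneFaces_facet
    (hcompat : ∀ i j, ∀ s ∈ facetImage i (K i), (∀ v ∈ s, v j = 0) → s ∈ facetImage j (K j))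
    {u : Fin (n + 2) → ℝ} (hupos : ∀ i, 0 < u i) (i : Fin (n + 2)) :
    {s ∈ coneFaces u (⋃ i, facetImage i (K i)) | ∀ x ∈ s, x i = 0} = facetImage i (K i) := by
  ext s
  constructor
  · rintro ⟨(hs | rfl) | ⟨s, hs, rfl⟩, h⟩
    · obtain ⟨j, hs⟩ := Set.mem_iUnion.1 hs
      exact hcompat j i s hs h
    · exact absurd (h u (by simp)) (hupos i).ne'
    · exact absurd (h u (by simp)) (hupos i).ne'
  · intro hs
    exact ⟨Or.inl (Or.inl (Set.mem_iUnion.2 ⟨i, hs⟩)), facetImage_coord hs⟩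

end Triangulation

/-! ### Construction of pseudo-barycentric systems -/

section Construction

/-- The requirements on the pseudo-barycentre of a simplex, for a family `𝒮` of simplexes to be in
general position with and a triangulation `L` of the boundary. -/
def IsGoodCenter {n : ℕ} (𝒮 L : Set (Finset (Fin (n + 1) → ℝ))) (u : Simp n) : Prop :=
  (∀ i, centerBound n ≤ u.1 i) ∧ ∀ B ∈ L, ∀ T ∈ 𝒮, StrongGeneralPosition T B u.1

lemma exists_isGoodCenter {n : ℕ} (hn : n ≠ 0) {𝒮 L : Set (Finset (Fin (n + 1) → ℝ))}
    (h𝒮 : 𝒮.Finite) (h𝒮s : ∀ T ∈ 𝒮, IsSimplex T) (h𝒮S : ∀ T ∈ 𝒮, ∀ v ∈ T, v ∈ Simp n)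
    (hL : L.Finite)
    (hLl : ∀ B ∈ L, LinearIndependent ℝ (Subtype.val : {x // x ∈ B} → Fin (n + 1) → ℝ))
    (hLS : ∀ B ∈ L, ∀ v ∈ B, v ∈ Simp n) (hLi : ∀ B ∈ L, ∃ i, ∀ v ∈ B, v i = 0) :
    ∃ u, IsGoodCenter 𝒮 L u := by
  classical
  set 𝒲 : Set (Submodule ℝ (Fin (n + 1) → ℝ)) := ⋃ T ∈ 𝒮, ⋃ B ∈ L,
    (fun q : Finset (Fin (n + 1) → ℝ) × Finset (Fin (n + 1) → ℝ) =>
      Submodule.span ℝ ((q.1 : Set (Fin (n + 1) → ℝ)) ∪ q.2)) '' (T.powerset ×ˢ B.powerset : Finset _)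
    with h𝒲
  have hfin : 𝒲.Finite := h𝒮.biUnion fun T _ => hL.biUnion fun B _ =>
    (Finset.finite_toSet _).image _
  obtain ⟨u, hu, huW⟩ := exists_generic_center hn hfin
  refine ⟨u, hu, fun B hB T hT => ?_⟩
  refine strongGeneralPosition_of_generic (h𝒮s T hT) (h𝒮S T hT) (hLl B hB) (hLS B hB) (hLi B hB)
    u.2 (fun i => (centerBound_pos n).trans_le (hu i)) fun T' hT' B' hB' hne => huW _ ?_ hne
  rw [h𝒲]
  refine Set.mem_biUnion hT (Set.mem_biUnion hB ⟨(T', B'), ?_, rfl⟩)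
  rw [Finset.mem_coe, Finset.mem_product, Finset.mem_powerset, Finset.mem_powerset]
  exact ⟨hT', hB'⟩

/-- The vertex of the `0`-simplex. -/
def simpPoint : Simp 0 := ⟨fun _ => 1, fun _ => zero_le_one, by simp⟩

lemma simp_zero_eq (x : Simp 0) : x = simpPoint := by
  refine Subtype.ext (funext fun i => ?_)
  have := x.2.2
  rw [Fin.sum_univ_one] at this
  rw [Fin.fin_one_eq_zero i, this]
  rfl

variable {X : Type*} [TopologicalSpace X] {F : Filtration X} (𝒯 : SimplicialSystem F)

/-- The pseudo-barycentres and the triangulations, by recursion on the dimension. -/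
def systemData : (n : ℕ) → Sing X n → Simp n × Set (Finset (Fin (n + 1) → ℝ))
  | 0, _ => (simpPoint, {{simpPoint.1}})
  | n + 1, σ =>
    let L := ⋃ i, facetImage i (systemData n (face i σ)).2
    -- Choosing by `Classical.epsilon` separates the recursion from the proof that a good centre
    -- exists; the point supplied only shows that the type is inhabited.
    let u := @Classical.epsilon (Simp (n + 1)) ⟨coface 0 (systemData n (face 0 σ)).1⟩
      (IsGoodCenter {T | ∃ S : Stratum F, T ∈ 𝒯.env σ S} L)
    (u, coneFaces u.1 L)

/-- The simplexes of the triangulation of the boundary. -/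
def systemBoundary {n : ℕ} (σ : Sing X (n + 1)) : Set (Finset (Fin (n + 2) → ℝ)) :=
  ⋃ i, facetImage i (systemData 𝒯 n (face i σ)).2

/-- Two facets induce the same triangulation on their intersection. -/
def FacetsCompatible {n : ℕ} (σ : Sing X (n + 1)) : Prop :=
  ∀ i j, ∀ s ∈ facetImage i (systemData 𝒯 n (face i σ)).2, (∀ v ∈ s, v j = 0) →
    s ∈ facetImage j (systemData 𝒯 n (face j σ)).2

lemma systemData_succ_snd {n : ℕ} (σ : Sing X (n + 1)) :
    (systemData 𝒯 (n + 1) σ).2 = coneFaces (systemData 𝒯 (n + 1) σ).1.1 (systemBoundary 𝒯 σ) :=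
  rfl

variable {𝒯}

lemma systemBoundary_spec {n : ℕ} {σ : Sing X (n + 1)}
    (hK : ∀ i, IsTriangulation (systemData 𝒯 n (face i σ)).2) (hc : FacetsCompatible 𝒯 σ) :
    (systemBoundary 𝒯 σ).Finite ∧
    (∀ B ∈ systemBoundary 𝒯 σ,
      LinearIndependent ℝ (Subtype.val : {x // x ∈ B} → Fin (n + 2) → ℝ)) ∧
    (∀ B ∈ systemBoundary 𝒯 σ, ∀ v ∈ B, v ∈ Simp (n + 1)) ∧
    (∀ B ∈ systemBoundary 𝒯 σ, ∃ i, ∀ v ∈ B, v i = 0) := by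
  refine ⟨Set.finite_iUnion fun i => (hK i).finite.image _, fun B hB =>
    (uniqueWeights_boundary hK hc).linearIndependent (Or.inr hB), fun B hB v hv => ?_,
    fun B hB => ?_⟩
  · obtain ⟨i, s, hs, rfl⟩ := Set.mem_iUnion.1 hB
    obtain ⟨y, hy, rfl⟩ := Finset.mem_image.1 hv
    exact facetIncl_mem i ((hK i).subset_simp s hs y hy)
  · obtain ⟨i, hB⟩ := Set.mem_iUnion.1 hB
    exact ⟨i, facetImage_coord hB⟩

lemma systemData_isGoodCenter (hF : F.LocallyFinite) {n : ℕ} {σ : Sing X (n + 1)}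
    (hK : ∀ i, IsTriangulation (systemData 𝒯 n (face i σ)).2) (hc : FacetsCompatible 𝒯 σ) :
    IsGoodCenter {T | ∃ S : Stratum F, T ∈ 𝒯.env σ S} (systemBoundary 𝒯 σ)
      (systemData 𝒯 (n + 1) σ).1 := by
  obtain ⟨h1, h2, h3, h4⟩ := systemBoundary_spec hK hc
  have := exists_isGoodCenter (Nat.succ_ne_zero n) (𝒯.finite_env hF σ)
    (fun T ⟨S, hT⟩ => 𝒯.isSimplex σ S T hT)
    (fun T ⟨S, hT⟩ v hv => 𝒯.subset_simp σ S T hT hv) h1 h2 h3 h4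
  exact Classical.epsilon_spec this

lemma isTriangulation_zero : IsTriangulation (n := 0) {{simpPoint.1}} where
  finite := Set.finite_singleton _
  nonempty := by rintro s rfl; exact Finset.singleton_nonempty _
  subset_simp := by
    rintro s rfl v hv
    rw [Finset.mem_singleton.1 hv]
    exact simpPoint.2
  down_closed := by
    rintro s rfl t hts ht
    rcases Finset.subset_singleton_iff.1 hts with rfl | rfl
    · simp at ht
    · rfl
  unique := by
    rintro s rfl t rfl w w' - - hw hw' h
    rw [Finset.sum_singleton, Finset.sum_singleton] at h
    funext v
    by_cases hv : v = simpPoint.1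
    · have := congrFun h 0
      simpa [simpPoint, hv] using this
    · rw [hw v (by simpa using hv), hw' v (by simpa using hv)]
  covers := fun x hx => ⟨{simpPoint.1}, rfl, by
    have := congrArg Subtype.val (simp_zero_eq ⟨x, hx⟩)
    simpa using this⟩
  common := by
    rintro s rfl
    refine ⟨0, fun v hv => ?_⟩
    rw [Finset.mem_singleton.1 hv]
    simp [centerBound, simpPoint]

lemma facetsCompatible_one (σ : Sing X 1) : FacetsCompatible 𝒯 σ := by
  rintro i j s hs hj
  by_cases hij : i = j
  · exact hij ▸ hs
  obtain ⟨s, rfl, rfl⟩ := hs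
  have := hj (facetIncl i simpPoint.1) (by simp)
  obtain ⟨k, rfl⟩ := Fin.exists_succAbove_eq (Ne.symm hij)
  rw [facetIncl_succAbove] at this
  exact absurd this one_ne_zero

/-- A simplex of facet `i` lying in facet `j` belongs to their common face. Its triangulation there
comes from an iterated face of `σ`, which `face_face` identifies with the one reached through facet
`j`. -/
lemma facetsCompatible_succ {n : ℕ}
    (hc : ∀ σ : Sing X (n + 1), FacetsCompatible 𝒯 σ)
    (hpos : ∀ (σ : Sing X (n + 1)) i, 0 < (systemData 𝒯 (n + 1) σ).1.1 i)
    (σ : Sing X (n + 2)) : FacetsCompatible 𝒯 σ := by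
  rintro i j s hs hj
  by_cases hij : i = j
  · exact hij ▸ hs
  obtain ⟨s, hs, rfl⟩ := hs
  obtain ⟨k, rfl⟩ := Fin.exists_succAbove_eq (Ne.symm hij)
  have hsk : ∀ v ∈ s, v k = 0 := fun v hv => by
    simpa using hj (facetIncl i v) (Finset.mem_image_of_mem _ hv)
  have hs' : s ∈ facetImage k (systemData 𝒯 n (face k (face i σ))).2 := by
    rw [← coneFaces_facet (K := fun k => (systemData 𝒯 n (face k (face i σ))).2)
      (hc (face i σ)) (hpos (face i σ)) k]
    exact ⟨hs, hsk⟩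
  obtain ⟨r, hr, rfl⟩ := hs'
  refine ⟨r.image (facetIncl (k.predAbove i)), ?_, ?_⟩
  · rw [systemData_succ_snd]
    refine Or.inl (Or.inl (Set.mem_iUnion.2 ⟨k.predAbove i, r, ?_, rfl⟩))
    rwa [face_face]
  · simp only [Finset.image_image]
    refine Finset.image_congr fun x _ => ?_
    exact facetIncl_facetIncl i k x

/-- The induction must be joint: compatible facets in dimension `n + 1` make the cone a
triangulation with a good centre, and interiority of the centre yields compatibility in dimension `n
+ 2`. -/
lemma systemData_spec (hF : F.LocallyFinite) (n : ℕ) :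
    (∀ σ : Sing X n, IsTriangulation (systemData 𝒯 n σ).2 ∧
      ∀ i, centerBound n ≤ (systemData 𝒯 n σ).1.1 i) ∧
    ∀ σ : Sing X (n + 1), FacetsCompatible 𝒯 σ := by
  induction n with
  | zero =>
    refine ⟨fun σ => ⟨isTriangulation_zero, fun i => ?_⟩, facetsCompatible_one⟩
    simp [centerBound, systemData, simpPoint]
  | succ n ih =>
    have h : ∀ σ : Sing X (n + 1), IsTriangulation (systemData 𝒯 (n + 1) σ).2 ∧
        ∀ i, centerBound (n + 1) ≤ (systemData 𝒯 (n + 1) σ).1.1 i := fun σ => by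
      have hg := systemData_isGoodCenter hF (fun i => (ih.1 (face i σ)).1) (ih.2 σ)
      exact ⟨isTriangulation_cone (fun i => (ih.1 (face i σ)).1) (ih.2 σ)
        (systemData 𝒯 (n + 1) σ).1.2 hg.1, hg.1⟩
    exact ⟨h, facetsCompatible_succ ih.2 fun σ i => (centerBound_pos _).trans_le ((h σ).2 i)⟩

variable (𝒯)

/-- A pseudo-barycentric system whose pseudo-barycentres are generic and not too far from the
barycentres. -/
def pseudoBarycentricSystem (hF : F.LocallyFinite) : PseudoBarycentricSystem 𝒯 where
  center := fun {n} σ => (systemData 𝒯 n σ).1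
  tri := fun {n} σ => (((systemData_spec hF n).1 σ).1).complex
  tri_space := fun _ => IsTriangulation.space_complex _
  center_pos := fun {n} σ i => (centerBound_pos n).trans_le (((systemData_spec hF n).1 σ).2 i)
  tri_facet := fun {n} σ i =>
    coneFaces_facet (K := fun i => (systemData 𝒯 n (face i σ)).2) ((systemData_spec hF n).2 σ)
      (fun i => (centerBound_pos _).trans_le (((systemData_spec hF (n + 1)).1 σ).2 i)) i
  tri_cone := fun _ => rfl
  diam_le := fun {n} σ _ hs => IsTriangulation.diam_le ((systemData_spec hF n).1 σ).1 hs
  general_position := fun {n} σ B hB S T hT =>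
    (systemData_isGoodCenter hF (fun i => ((systemData_spec hF n).1 (face i σ)).1)
      ((systemData_spec hF n).2 σ)).2 B hB T ⟨S, hT⟩

lemma centerBound_le_center (hF : F.LocallyFinite) {n : ℕ} (σ : Sing X n) (i : Fin (n + 1)) :
    centerBound n ≤ ((pseudoBarycentricSystem 𝒯 hF).center σ).1 i :=
  ((systemData_spec hF n).1 σ).2 i

end Construction

/-! ### Affine chains of the standard simplex -/

section AffineChains

/-- Integral combinations of affine `k`-simplexes of `Δⁿ`, given by their vertices. -/
abbrev AffineChain (k n : ℕ) : Type := (Fin (k + 1) → Simp n) →₀ ℤ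

variable {k n : ℕ}

/-- The boundary operator on affine chains. -/
def affineBoundary (k n : ℕ) : AffineChain (k + 1) n →ₗ[ℤ] AffineChain k n :=
  Finsupp.linearCombination ℤ fun v => ∑ i : Fin (k + 2), ((-1 : ℤ) ^ (i : ℕ)) •
    Finsupp.single (fun j => v (i.succAbove j)) 1

/-- The operator on affine chains induced by the inclusion of a facet. -/
def affineCoface (k : ℕ) (i : Fin (n + 2)) : AffineChain k n →ₗ[ℤ] AffineChain k (n + 1) :=
  Finsupp.lmapDomain ℤ ℤ fun v j => coface i (v j)

/-- The cone with apex `u` on affine chains. -/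
def affineCone (k : ℕ) (u : Simp n) : AffineChain k n →ₗ[ℤ] AffineChain (k + 1) n :=
  Finsupp.lmapDomain ℤ ℤ fun v => (Fin.cons u v : Fin (k + 2) → Simp n)

lemma affineBoundary_single (v : Fin (k + 2) → Simp n) :
    affineBoundary k n (Finsupp.single v 1) = ∑ i : Fin (k + 2), ((-1 : ℤ) ^ (i : ℕ)) •
      Finsupp.single (fun j => v (i.succAbove j)) 1 := by
  simp [affineBoundary]

lemma affineCoface_single (i : Fin (n + 2)) (v : Fin (k + 1) → Simp n) (m : ℤ) :
    affineCoface k i (Finsupp.single v m) = Finsupp.single (fun j => coface i (v j)) m := by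
  simp [affineCoface]

lemma affineCone_single (u : Simp n) (v : Fin (k + 1) → Simp n) (m : ℤ) :
    affineCone k u (Finsupp.single v m) =
      Finsupp.single (Fin.cons u v : Fin (k + 2) → Simp n) m := by
  simp [affineCone]

/-- Face 0 removes the apex; the other faces are cones on faces, with signs shifted by one. -/
lemma affineBoundary_affineCone (u : Simp n) (c : AffineChain (k + 1) n) :
    affineBoundary (k + 1) n (affineCone (k + 1) u c) =
      c - affineCone k u (affineBoundary k n c) := by
  suffices h : affineBoundary (k + 1) n ∘ₗ affineCone (k + 1) u =
      LinearMap.id - affineCone k u ∘ₗ affineBoundary k n from LinearMap.congr_fun h c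
  refine Finsupp.lhom_ext' fun v => LinearMap.ext_ring ?_
  simp only [LinearMap.comp_apply, Finsupp.lsingle_apply, LinearMap.sub_apply, LinearMap.id_apply,
    affineCone_single, affineBoundary_single, map_sum, map_smul]
  rw [Fin.sum_univ_succ, sub_eq_add_neg, ← Finset.sum_neg_distrib]
  congr 1
  · simp
  · refine Finset.sum_congr rfl fun i _ => ?_
    rw [Fin.val_succ, pow_succ, mul_neg_one, neg_smul]
    congr 3
    funext j
    refine Fin.cases ?_ (fun j => ?_) j
    · simp
    · simp

/-- In degree 0 the cone formula acquires an augmentation term, the apex itself. -/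
lemma affineBoundary_affineCone_zero (u : Simp n) (v : Fin 1 → Simp n) :
    affineBoundary 0 n (affineCone 0 u (Finsupp.single v 1)) =
      Finsupp.single v 1 - Finsupp.single (fun _ => u) 1 := by
  rw [affineCone_single, affineBoundary_single, Fin.sum_univ_two]
  have h1 : (fun j : Fin 1 => (Fin.cons u v : Fin 2 → Simp n) ((0 : Fin 2).succAbove j)) = v := by
    funext j; simp
  have h2 : (fun j : Fin 1 => (Fin.cons u v : Fin 2 → Simp n) ((1 : Fin 2).succAbove j)) =
      fun _ => u := by
    funext j; rw [Fin.fin_one_eq_zero j]; rfl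
  rw [h1, h2]
  simp [sub_eq_add_neg]

lemma affineBoundary_affineCoface (i : Fin (n + 2)) (c : AffineChain (k + 1) n) :
    affineBoundary k (n + 1) (affineCoface (k + 1) i c) =
      affineCoface k i (affineBoundary k n c) := by
  suffices h : affineBoundary k (n + 1) ∘ₗ affineCoface (k + 1) i =
      affineCoface k i ∘ₗ affineBoundary k n from LinearMap.congr_fun h c
  refine Finsupp.lhom_ext' fun v => LinearMap.ext_ring ?_
  simp only [LinearMap.comp_apply, Finsupp.lsingle_apply, affineCoface_single,
    affineBoundary_single, map_sum, map_smul]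

lemma affineCoface_affineCoface (j : Fin (n + 3)) (i : Fin (n + 2)) (c : AffineChain k n) :
    affineCoface k (j.succAbove i) (affineCoface k (i.predAbove j) c) =
      affineCoface k j (affineCoface k i c) := by
  suffices h : affineCoface k (j.succAbove i) ∘ₗ affineCoface k (i.predAbove j) =
      affineCoface k j ∘ₗ affineCoface k i from LinearMap.congr_fun h c
  refine Finsupp.lhom_ext' fun v => LinearMap.ext_ring ?_
  simp only [LinearMap.comp_apply, Finsupp.lsingle_apply, affineCoface_single, coface_coface]

/-- Exchanging the order in which two facets are taken is a fixed-point-free, sign-reversing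
involution. This is the cancellation behind `∂∂ = 0`. -/
lemma sum_sum_neg_one_pow_smul_eq_zero {A : Type*} [AddCommGroup A]
    (f : Fin (n + 3) → Fin (n + 2) → A)
    (hf : ∀ i j, f (i.succAbove j) (j.predAbove i) = f i j) :
    ∑ i : Fin (n + 3), ((-1 : ℤ) ^ (i : ℕ)) •
      ∑ j : Fin (n + 2), ((-1 : ℤ) ^ (j : ℕ)) • f i j = 0 := by
  simp only [Finset.smul_sum, smul_smul, ← pow_add]
  rw [← Finset.sum_product']
  refine Finset.sum_involution (fun q _ => (q.1.succAbove q.2, q.2.predAbove q.1)) ?_ ?_ ?_ ?_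
  · rintro ⟨i, j⟩ -
    simp only [hf, Fin.neg_one_pow_succAbove_add_predAbove, neg_smul, add_neg_cancel]
  · rintro ⟨i, j⟩ - - h
    exact Fin.succAbove_ne i j (congrArg Prod.fst h)
  · simp
  · rintro ⟨i, j⟩ -
    simp [Fin.succAbove_succAbove_predAbove, Fin.predAbove_predAbove_succAbove]

end AffineChains

/-! ### Operators on singular chains given by affine chains -/

section Models

variable {X : Type*} [TopologicalSpace X] {k n : ℕ}

/-- The alternating sum of the images of the affine chains of the faces of a simplex. -/
def modelBoundary (M : Sing X n → AffineChain k n) (σ : Sing X (n + 1)) : AffineChain k (n + 1) :=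
  ∑ i : Fin (n + 2), ((-1 : ℤ) ^ (i : ℕ)) • affineCoface k i (M (face i σ))

lemma affineBoundary_modelBoundary (M : Sing X n → AffineChain (k + 1) n) (σ : Sing X (n + 1)) :
    affineBoundary k (n + 1) (modelBoundary M σ) =
      modelBoundary (fun τ => affineBoundary k n (M τ)) σ := by
  simp only [modelBoundary, map_sum, map_smul, affineBoundary_affineCoface]

lemma modelBoundary_modelBoundary (M : Sing X n → AffineChain k n) (σ : Sing X (n + 2)) :
    modelBoundary (modelBoundary M) σ = 0 := by
  simp only [modelBoundary, map_sum, map_smul]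
  refine sum_sum_neg_one_pow_smul_eq_zero
    (fun i j => affineCoface k i (affineCoface k j (M (face j (face i σ))))) fun i j => ?_
  rw [face_face, affineCoface_affineCoface]

lemma modelBoundary_sub (M N : Sing X n → AffineChain k n) (σ : Sing X (n + 1)) :
    modelBoundary (fun τ => M τ - N τ) σ = modelBoundary M σ - modelBoundary N σ := by
  simp only [modelBoundary, map_sub, smul_sub, Finset.sum_sub_distrib]

/-- The `j`-th vertex of the standard simplex. -/
def vertex (n : ℕ) (j : Fin (n + 1)) : Simp n := ⟨Pi.single j 1, single_mem_stdSimplex ℝ j⟩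

lemma coface_vertex (i : Fin (n + 2)) (j : Fin (n + 1)) :
    coface i (vertex n j) = vertex (n + 1) (i.succAbove j) := by
  refine Subtype.ext (funext fun c => ?_)
  change facetIncl i (Pi.single j 1) c = (Pi.single (i.succAbove j) 1 : Fin (n + 2) → ℝ) c
  refine Fin.succAboveCases i ?_ (fun d => ?_) c
  · rw [facetIncl_same, Pi.single_eq_of_ne (Fin.succAbove_ne i j).symm]
  · rw [facetIncl_succAbove]
    simp [Pi.single_apply]

/-- The identity of the standard simplex, as an affine chain. -/
def affineIdentity (n : ℕ) : AffineChain n n := Finsupp.single (vertex n) 1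

lemma affineBoundary_affineIdentity (σ : Sing X (n + 1)) :
    affineBoundary n (n + 1) (affineIdentity (n + 1)) =
      modelBoundary (fun _ => affineIdentity n) σ := by
  simp only [affineIdentity, affineBoundary_single, modelBoundary, affineCoface_single,
    coface_vertex]

/-! ### Boundary identities for the models of the subdivision and of the homotopy. -/

variable (u : ∀ {n : ℕ}, Sing X n → Simp n)

lemma sdModel_zero (σ : Sing X 0) : sdModel u σ = affineIdentity 0 := by
  rw [sdModel, affineIdentity]
  congr 1
  funext j
  rw [simp_zero_eq (u σ), simp_zero_eq (vertex 0 j)]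

lemma sdModel_succ (σ : Sing X (n + 1)) :
    sdModel u σ = affineCone n (u σ) (modelBoundary (sdModel u) σ) := by
  rw [modelBoundary, map_sum]
  refine Finset.sum_congr rfl fun i _ => ?_
  rw [map_smul]
  exact congrArg (fun c => ((-1 : ℤ) ^ (i : ℕ)) • c) (Finsupp.mapDomain_comp
    (g := fun v => (Fin.cons (u σ) v : Fin (n + 2) → Simp (n + 1)))
    (f := fun (v : Fin (n + 1) → Simp n) j => coface i (v j)))

/-- By induction, `∂(u * sd ∂σ) = sd ∂σ - u * sd ∂∂σ = sd ∂σ`. For a 1-simplex, the two augmentation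
terms at `u` cancel instead. -/
lemma affineBoundary_sdModel (σ : Sing X (n + 1)) :
    affineBoundary n (n + 1) (sdModel u σ) = modelBoundary (sdModel u) σ := by
  induction n with
  | zero =>
    have h : ∀ τ : Sing X 0, sdModel u τ = Finsupp.single (vertex 0) 1 := sdModel_zero u
    have h0 := affineBoundary_affineCone_zero (u σ) fun j => coface 0 (vertex 0 j)
    have h1 := affineBoundary_affineCone_zero (u σ) fun j => coface 1 (vertex 0 j)
    rw [sdModel_succ]
    simp only [modelBoundary, h, affineCoface_single]
    rw [Fin.sum_univ_two]
    simp only [Fin.val_zero, Fin.val_one, pow_zero, pow_one, one_smul, neg_smul, map_add, map_neg]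
    refine (congrArg₂ (fun a b => a + -b) h0 h1).trans ?_
    abel
  | succ n ih =>
    have h : (fun τ : Sing X (n + 1) => affineBoundary n (n + 1) (sdModel u τ)) =
        modelBoundary (sdModel u) := funext ih
    rw [sdModel_succ, affineBoundary_affineCone, affineBoundary_modelBoundary, h,
      modelBoundary_modelBoundary, map_zero, sub_zero]

/-- The affine chains of the homotopy from `sd` to the identity,
`T σ = u_σ * (σ - T (∂σ))`. -/
def homotopyModel (u : ∀ {n : ℕ}, Sing X n → Simp n) : ∀ {n : ℕ}, Sing X n → AffineChain (n + 1) n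
  | 0, σ => affineCone 0 (u σ) (affineIdentity 0)
  | n + 1, σ => affineCone (n + 1) (u σ)
      (affineIdentity (n + 1) - modelBoundary (homotopyModel u) σ)

lemma affineBoundary_homotopyModel_zero (σ : Sing X 0) :
    affineBoundary 0 0 (homotopyModel u σ) = affineIdentity 0 - sdModel u σ := by
  rw [homotopyModel, affineIdentity, affineBoundary_affineCone_zero, sdModel]

lemma affineBoundary_homotopyModel_succ (σ : Sing X (n + 1)) :
    affineBoundary (n + 1) (n + 1) (homotopyModel u σ) =
      affineIdentity (n + 1) - sdModel u σ - modelBoundary (homotopyModel u) σ := by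
  -- The cone formula leaves `u * (∂σ - ∂T∂σ)`, which is `u * sd ∂σ = sd σ` as soon as `∂T∂σ = ∂σ -
  -- sd ∂σ`. Below, this follows from the formula on points in the base case, and from the induction
  -- hypothesis with `T∂∂ = 0` otherwise.
  have step : ∀ {n : ℕ} (σ : Sing X (n + 1)),
      modelBoundary (fun τ => affineBoundary n n (homotopyModel u τ)) σ =
        modelBoundary (fun _ => affineIdentity n) σ - modelBoundary (sdModel u) σ →
      affineBoundary (n + 1) (n + 1) (homotopyModel u σ) =
        affineIdentity (n + 1) - sdModel u σ - modelBoundary (homotopyModel u) σ := by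
    intro n σ key
    rw [homotopyModel, affineBoundary_affineCone, map_sub, affineBoundary_modelBoundary, key,
      affineBoundary_affineIdentity σ, sub_sub_cancel, ← sdModel_succ]
    abel
  induction n with
  | zero =>
    refine step σ ?_
    rw [← modelBoundary_sub]
    exact congrArg (fun M => modelBoundary M σ)
      (funext fun τ => affineBoundary_homotopyModel_zero u τ)
  | succ n ih =>
    refine step σ ?_
    have h : (fun τ => affineBoundary (n + 1) (n + 1) (homotopyModel u τ)) =
        fun τ : Sing X (n + 1) => affineIdentity (n + 1) - sdModel u τ -
          modelBoundary (homotopyModel u) τ := funext ih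
    rw [h, modelBoundary_sub, modelBoundary_sub, modelBoundary_modelBoundary, sub_zero]

/-! ### From affine models to operators on singular chains. -/

variable (R : Type*) [CommRing R] (G : Type*) [AddCommGroup G] [Module R G]

/-- The image of an affine chain under a singular simplex. -/
def pushforward (k : ℕ) (σ : Sing X n) : AffineChain k n →ₗ[ℤ] (G →ₗ[R] Chain X G k) :=
  Finsupp.linearCombination ℤ fun v => Finsupp.lsingle (σ.comp (affineSimplex v))

/-- The operator on singular chains given by an affine chain for each singular simplex. -/
def modelOp (M : Sing X n → AffineChain k n) : Chain X G n →ₗ[R] Chain X G k :=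
  Finsupp.lsum R fun σ => pushforward R G k σ (M σ)

lemma sd_eq_modelOp (n : ℕ) : sd R G u n = modelOp R G (sdModel u) := rfl

lemma modelOp_single (M : Sing X n → AffineChain k n) (σ : Sing X n) (g : G) :
    modelOp R G M (Finsupp.single σ g) = pushforward R G k σ (M σ) g := by
  simp [modelOp]

lemma pushforward_single (σ : Sing X n) (v : Fin (k + 1) → Simp n) :
    pushforward R G k σ (Finsupp.single v 1) = Finsupp.lsingle (σ.comp (affineSimplex v)) := by
  simp [pushforward]

lemma boundary_single (τ : Sing X (n + 1)) (g : G) :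
    boundary X R G n (Finsupp.single τ g) =
      ∑ i : Fin (n + 2), ((-1 : ℤ) ^ (i : ℕ)) • Finsupp.single (face i τ) g := by
  simp [boundary]

lemma affineSimplex_coface (v : Fin (k + 2) → Simp n) (i : Fin (k + 2)) :
    (affineSimplex v).comp (coface i) = affineSimplex fun j => v (i.succAbove j) := by
  refine ContinuousMap.ext fun x => Subtype.ext ?_
  change ∑ j, facetIncl i x.1 j • (v j).1 = ∑ j, x.1 j • (v (i.succAbove j)).1
  rw [Fin.sum_univ_succAbove _ i]
  simp

lemma coface_affineSimplex (v : Fin (k + 1) → Simp n) (i : Fin (n + 2)) :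
    (coface i).comp (affineSimplex v) = affineSimplex fun j => coface i (v j) := by
  refine ContinuousMap.ext fun x => Subtype.ext ?_
  exact facetIncl_sum_smul i Finset.univ x.1 fun j => (v j).1

lemma affineSimplex_vertex : affineSimplex (vertex n) = ContinuousMap.id (Simp n) := by
  refine ContinuousMap.ext fun x => Subtype.ext (funext fun i => ?_)
  change (∑ j, x.1 j • (Pi.single j 1 : Fin (n + 1) → ℝ)) i = x.1 i
  simp [Finset.sum_apply, Pi.single_apply]

lemma boundary_pushforward (σ : Sing X n) (c : AffineChain (k + 1) n) (g : G) :
    boundary X R G k (pushforward R G (k + 1) σ c g) =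
      pushforward R G k σ (affineBoundary k n c) g := by
  induction c using Finsupp.induction_linear with
  | zero => simp
  | add c d hc hd => simp only [map_add, LinearMap.add_apply, hc, hd]
  | single v m =>
    rw [show (Finsupp.single v m : AffineChain (k + 1) n) = m • Finsupp.single v 1 by simp]
    simp only [map_zsmul, LinearMap.smul_apply]
    congr 1
    rw [pushforward_single, affineBoundary_single, Finsupp.lsingle_apply, boundary_single]
    simp only [map_sum, map_smul, pushforward_single, LinearMap.sum_apply, LinearMap.smul_apply,
      Finsupp.lsingle_apply, ← affineSimplex_coface]
    rfl

lemma pushforward_face (σ : Sing X (n + 1)) (i : Fin (n + 2)) (c : AffineChain k n) :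
    pushforward R G k (face i σ) c = pushforward R G k σ (affineCoface k i c) := by
  suffices h : pushforward R G k (face i σ) = pushforward R G k σ ∘ₗ affineCoface k i from
    LinearMap.congr_fun h c
  refine Finsupp.lhom_ext' fun v => LinearMap.ext_ring ?_
  simp only [LinearMap.comp_apply, Finsupp.lsingle_apply, affineCoface_single, pushforward_single,
    ← coface_affineSimplex]
  rfl

lemma boundary_comp_modelOp (M : Sing X n → AffineChain (k + 1) n) :
    boundary X R G k ∘ₗ modelOp R G M = modelOp R G fun σ => affineBoundary k n (M σ) := by
  refine Finsupp.lhom_ext fun σ g => ?_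
  rw [LinearMap.comp_apply, modelOp_single, modelOp_single, boundary_pushforward]

/-- Naturality of pushforward under faces. With `boundary_comp_modelOp`, it reduces identities
between operators on singular chains to identities between models. -/
lemma modelOp_comp_boundary (M : Sing X n → AffineChain k n) :
    modelOp R G M ∘ₗ boundary X R G n = modelOp R G (modelBoundary M) := by
  refine Finsupp.lhom_ext fun σ g => ?_
  rw [LinearMap.comp_apply, boundary_single, modelOp_single, modelBoundary]
  simp only [map_sum, map_zsmul, modelOp_single, LinearMap.sum_apply, LinearMap.smul_apply,
    pushforward_face]

lemma modelOp_affineIdentity :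
    modelOp R G (fun _ : Sing X n => affineIdentity n) = LinearMap.id := by
  refine Finsupp.lhom_ext fun σ g => ?_
  rw [modelOp_single, affineIdentity, pushforward_single, affineSimplex_vertex]
  rfl

lemma modelOp_add (M N : Sing X n → AffineChain k n) :
    modelOp R G (fun σ => M σ + N σ) = modelOp R G M + modelOp R G N := by
  refine Finsupp.lhom_ext fun σ g => ?_
  simp only [LinearMap.add_apply, modelOp_single, map_add]

lemma modelOp_sub (M N : Sing X n → AffineChain k n) :
    modelOp R G (fun σ => M σ - N σ) = modelOp R G M - modelOp R G N := by
  refine Finsupp.lhom_ext fun σ g => ?_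
  simp only [LinearMap.sub_apply, modelOp_single, map_sub]

lemma modelOp_mem_supported (M : Sing X n → AffineChain k n) (P : Set (Sing X k))
    (ξ : Chain X G n)
    (h : ∀ σ ∈ ξ.support, ∀ v ∈ (M σ).support, σ.comp (affineSimplex v) ∈ P) :
    modelOp R G M ξ ∈ Finsupp.supported G R P := by
  rw [modelOp, Finsupp.lsum_apply]
  refine Submodule.sum_mem _ fun σ hσ => ?_
  change (pushforward R G k σ (M σ)) (ξ σ) ∈ _
  rw [pushforward, Finsupp.linearCombination_apply, Finsupp.sum, LinearMap.sum_apply]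
  refine Submodule.sum_mem _ fun v hv => ?_
  rw [LinearMap.smul_apply]
  exact zsmul_mem (Finsupp.single_mem_supported R _ (h σ hσ v hv)) _

end Models

/-! ### The affine simplexes of the models -/

section Supports

variable {k n : ℕ}

/-- The linear span of the vertices is the whole space. -/
def Spanning (v : Fin (k + 1) → Simp n) : Prop :=
  Submodule.span ℝ (Set.range fun j => (v j).1) = ⊤

lemma spanning_vertex (n : ℕ) : Spanning (vertex n) := by
  have := (Pi.basisFun ℝ (Fin (n + 1))).span_eq
  rw [Spanning, ← this]
  congr 2
  funext j
  simp [vertex]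

lemma Spanning.cons {v : Fin (k + 1) → Simp n} (hv : Spanning v) (u : Simp n) :
    Spanning (Fin.cons u v : Fin (k + 2) → Simp n) := by
  rw [Spanning, eq_top_iff, ← hv]
  refine Submodule.span_mono ?_
  rintro _ ⟨j, rfl⟩
  exact ⟨j.succ, by simp⟩

/-- The image of `v` spans the hyperplane where coordinate `i` vanishes, and `u` lies off it. -/
lemma Spanning.cons_coface {v : Fin (k + 1) → Simp n} (hv : Spanning v) {u : Simp (n + 1)}
    (hu : ∀ i, 0 < u.1 i) (i : Fin (n + 2)) :
    Spanning (Fin.cons u fun j => coface i (v j) : Fin (k + 2) → Simp (n + 1)) := by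
  rw [Spanning, eq_top_iff]
  intro x _
  set S := Submodule.span ℝ (Set.range fun j =>
    ((Fin.cons u fun j => coface i (v j) : Fin (k + 2) → Simp (n + 1)) j).1)
  have huS : u.1 ∈ S := Submodule.subset_span ⟨0, rfl⟩
  have hfacet : ∀ y : Fin (n + 1) → ℝ, facetIncl i y ∈ S := fun y => by
    have hy : y ∈ Submodule.span ℝ (Set.range fun j => (v j).1) := by
      rw [show Submodule.span ℝ (Set.range fun j => (v j).1) = ⊤ from hv]; trivial
    obtain ⟨c, rfl⟩ := (Submodule.mem_span_range_iff_exists_fun ℝ).1 hy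
    rw [facetIncl_sum_smul]
    exact Submodule.sum_mem _ fun j _ => Submodule.smul_mem _ _ (Submodule.subset_span ⟨j.succ, rfl⟩)
  have hx : x = (x i / u.1 i) • u.1 +
      facetIncl i fun l => x (i.succAbove l) - x i / u.1 i * u.1 (i.succAbove l) := by
    funext j
    refine Fin.succAboveCases i ?_ (fun l => ?_) j
    · simp [div_mul_cancel₀ _ (hu i).ne']
    · simp
  rw [hx]
  exact S.add_mem (S.smul_mem _ huS) (hfacet _)

lemma exists_of_mem_support_affineCone {u : Simp n} {c : AffineChain k n}
    {v : Fin (k + 2) → Simp n} (hv : v ∈ (affineCone k u c).support) :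
    ∃ w ∈ c.support, (Fin.cons u w : Fin (k + 2) → Simp n) = v := by
  classical
  exact Finset.mem_image.1 (Finsupp.mapDomain_support hv)

lemma exists_of_mem_support_modelBoundary {X : Type*} [TopologicalSpace X]
    {M : Sing X n → AffineChain k n} {σ : Sing X (n + 1)} {v : Fin (k + 1) → Simp (n + 1)}
    (hv : v ∈ (modelBoundary M σ).support) :
    ∃ i, ∃ w ∈ (M (face i σ)).support, (fun j => coface i (w j)) = v := by
  classical
  obtain ⟨i, -, hi⟩ := Finset.mem_biUnion.1 (Finsupp.support_finsetSum hv)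
  exact ⟨i, Finset.mem_image.1 (Finsupp.mapDomain_support (Finsupp.support_smul hi))⟩

variable {X : Type*} [TopologicalSpace X] {u : ∀ {n : ℕ}, Sing X n → Simp n}

lemma spanning_of_mem_support_affineIdentity {v : Fin (n + 1) → Simp n}
    (hv : v ∈ (affineIdentity n).support) : Spanning v := by
  rw [Finset.mem_singleton.1 (Finsupp.support_single_subset hv)]
  exact spanning_vertex n

lemma spanning_of_mem_support_sdModel (hu : ∀ {n : ℕ} (σ : Sing X n) i, 0 < (u σ).1 i)
    (σ : Sing X n) : ∀ v ∈ (sdModel u σ).support, Spanning v := by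
  induction n with
  | zero =>
    rw [sdModel_zero]
    exact fun v hv => spanning_of_mem_support_affineIdentity hv
  | succ n ih =>
    intro v hv
    rw [sdModel_succ] at hv
    obtain ⟨w, hw, rfl⟩ := exists_of_mem_support_affineCone hv
    obtain ⟨i, w', hw', rfl⟩ := exists_of_mem_support_modelBoundary hw
    exact (ih (face i σ) w' hw').cons_coface (hu σ) i

lemma spanning_of_mem_support_homotopyModel (hu : ∀ {n : ℕ} (σ : Sing X n) i, 0 < (u σ).1 i)
    (σ : Sing X n) : ∀ v ∈ (homotopyModel u σ).support, Spanning v := by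
  classical
  induction n with
  | zero =>
    intro v hv
    obtain ⟨w, hw, rfl⟩ := exists_of_mem_support_affineCone hv
    exact (spanning_of_mem_support_affineIdentity hw).cons _
  | succ n ih =>
    intro v hv
    rw [homotopyModel] at hv
    obtain ⟨w, hw, rfl⟩ := exists_of_mem_support_affineCone hv
    rcases Finset.mem_union.1 (Finsupp.support_sub hw) with hw | hw
    · exact (spanning_of_mem_support_affineIdentity hw).cons _
    · obtain ⟨i, w', hw', rfl⟩ := exists_of_mem_support_modelBoundary hw
      exact (ih (face i σ) w' hw').cons_coface (hu σ) i

lemma common_of_mem_support_sdModel (hu : ∀ {n : ℕ} (σ : Sing X n) i, centerBound n ≤ (u σ).1 i)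
    (σ : Sing X n) : ∀ v ∈ (sdModel u σ).support, ∃ e, ∀ j, centerBound n ≤ (v j).1 e := by
  induction n with
  | zero =>
    intro v _
    refine ⟨0, fun j => ?_⟩
    rw [simp_zero_eq (v j)]
    simp [centerBound, simpPoint]
  | succ n ih =>
    intro v hv
    rw [sdModel_succ] at hv
    obtain ⟨w, hw, rfl⟩ := exists_of_mem_support_affineCone hv
    obtain ⟨i, w', hw', rfl⟩ := exists_of_mem_support_modelBoundary hw
    obtain ⟨e, he⟩ := ih (face i σ) w' hw'
    refine ⟨i.succAbove e, fun j => ?_⟩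
    refine Fin.cases ?_ (fun j => ?_) j
    · exact hu σ _
    · refine (centerBound_succ_le n).trans ((he j).trans (le_of_eq ?_))
      exact (facetIncl_succAbove i (w' j).1 e).symm

lemma allowableChain_modelOp {F : Filtration X} {p : Perversity F} (R : Type*) [CommRing R]
    {G : Type*} [AddCommGroup G] [Module R G] {M : Sing X n → AffineChain k n}
    (hM : ∀ σ, ∀ v ∈ (M σ).support, Spanning v) {ξ : Chain X G n} (hξ : AllowableChain p ξ) :
    AllowableChain p (modelOp R G M ξ) := by
  have := modelOp_mem_supported R G M {τ | Allowable p τ} ξ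
    fun σ hσ v hv => (hξ σ hσ).comp_affineSimplex (hM σ v hv)
  exact fun τ hτ => (Finsupp.mem_supported R _).1 this hτ

end Supports

/-! ### Iterated subdivisions are small -/

section Small

variable {n : ℕ}

/-- The differences `x j - y j` sum to zero, so mass `c` at coordinate `e` can be removed from every
vertex without changing the difference of the images. The remainders are nonnegative of mass `1 -
c`. -/
lemma sum_abs_affineSimplex_sub_le {v : Fin (n + 1) → Simp n} {c : ℝ} {e : Fin (n + 1)}
    (he : ∀ j, c ≤ (v j).1 e) (x y : Simp n) :
    ∑ i, |(affineSimplex v x).1 i - (affineSimplex v y).1 i| ≤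
      (1 - c) * ∑ j, |x.1 j - y.1 j| := by
  set b : Fin (n + 1) → Fin (n + 1) → ℝ := fun j i => (v j).1 i - if i = e then c else 0 with hb
  have hb0 : ∀ j i, 0 ≤ b j i := fun j i => by
    simp only [hb]
    split_ifs with h
    · rw [h]; exact sub_nonneg.2 (he j)
    · rw [sub_zero]; exact (v j).2.1 i
  have hbs : ∀ j, ∑ i, b j i = 1 - c := fun j => by
    simp only [hb, Finset.sum_sub_distrib, (v j).2.2, Finset.sum_ite_eq', Finset.mem_univ, if_true]
  have hz : ∑ j, (x.1 j - y.1 j) = 0 := by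
    rw [Finset.sum_sub_distrib, x.2.2, y.2.2, sub_self]
  have hdiff : ∀ i, (affineSimplex v x).1 i - (affineSimplex v y).1 i =
      ∑ j, (x.1 j - y.1 j) * b j i := fun i => by
    change (∑ j, x.1 j • (v j).1) i - (∑ j, y.1 j • (v j).1) i = _
    simp only [hb, mul_sub, Finset.sum_sub_distrib, ← Finset.sum_mul, hz, zero_mul, sub_zero]
    simp only [Finset.sum_apply, Pi.smul_apply, smul_eq_mul, sub_mul, Finset.sum_sub_distrib]
  calc ∑ i, |(affineSimplex v x).1 i - (affineSimplex v y).1 i|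
      ≤ ∑ i, ∑ j, |x.1 j - y.1 j| * b j i := by
        refine Finset.sum_le_sum fun i _ => ?_
        rw [hdiff]
        refine (Finset.abs_sum_le_sum_abs _ _).trans (le_of_eq ?_)
        exact Finset.sum_congr rfl fun j _ => by rw [abs_mul, abs_of_nonneg (hb0 j i)]
    _ = (1 - c) * ∑ j, |x.1 j - y.1 j| := by
        rw [Finset.sum_comm, Finset.mul_sum]
        refine Finset.sum_congr rfl fun j _ => ?_
        rw [← Finset.mul_sum, hbs, mul_comm]

variable {X : Type*} [TopologicalSpace X]

/-- The restrictions of `σ` along self-maps of the standard simplex that are Lipschitz, with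
constant `q`, for the `ℓ¹` metric. -/
def lipschitzRestrictions (σ : Sing X n) (q : ℝ) : Set (Sing X n) :=
  {τ | ∃ a : C(Simp n, Simp n), τ = σ.comp a ∧
    ∀ x y, ∑ i, |(a x).1 i - (a y).1 i| ≤ q * ∑ i, |x.1 i - y.1 i|}

lemma centerBound_le_one (n : ℕ) : centerBound n ≤ 1 := by
  unfold centerBound
  rw [div_le_one (by positivity)]
  have : (0 : ℝ) ≤ n := n.cast_nonneg
  linarith

/-- Each stage has its own pseudo-barycentres, but the contraction ratio is uniform and Lipschitz
constants multiply under composition. -/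
lemma sd_pow_mem_supported (R : Type*) [CommRing R] (G : Type*) [AddCommGroup G] [Module R G]
    {u : ∀ {n : ℕ}, Sing X n → Simp n}
    (hu : ∀ {n : ℕ} (σ : Sing X n) i, centerBound n ≤ (u σ).1 i) (σ : Sing X n) (r : ℕ) (g : G) :
    (sd R G u n ^ r) (Finsupp.single σ g) ∈
      Finsupp.supported G R (lipschitzRestrictions σ ((1 - centerBound n) ^ r)) := by
  induction r with
  | zero =>
    exact Finsupp.single_mem_supported R _ ⟨ContinuousMap.id _, rfl, fun x y => by simp⟩
  | succ r ih =>
    rw [pow_succ' (sd R G u n), Module.End.mul_apply, sd_eq_modelOp]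
    refine modelOp_mem_supported R G _ _ _ fun τ hτ v hv => ?_
    obtain ⟨a, rfl, ha⟩ := (Finsupp.mem_supported R _).1 ih hτ
    obtain ⟨e, he⟩ := common_of_mem_support_sdModel hu _ v hv
    refine ⟨a.comp (affineSimplex v), rfl, fun x y => (ha _ _).trans ?_⟩
    rw [pow_succ, mul_assoc]
    exact mul_le_mul_of_nonneg_left (sum_abs_affineSimplex_sub_le he x y)
      (pow_nonneg (sub_nonneg.2 (centerBound_le_one n)) r)

lemma exists_range_subset_of_lipschitz {𝒰 : Set (Set X)} (hopen : ∀ U ∈ 𝒰, IsOpen U)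
    (hcov : ⋃₀ 𝒰 = Set.univ) (σ : Sing X n) {q : ℝ} (hq0 : 0 ≤ q) (hq1 : q < 1) :
    ∃ r : ℕ, ∀ τ ∈ lipschitzRestrictions σ (q ^ r), ∃ U ∈ 𝒰, Set.range τ ⊆ U := by
  have hcomp : CompactSpace (Simp n) :=
    isCompact_iff_compactSpace.1 (isCompact_stdSimplex (𝕜 := ℝ) (Fin (n + 1)))
  obtain ⟨δ, hδ, hball⟩ := lebesgue_number_lemma_of_metric (s := (Set.univ : Set (Simp n)))
    (c := fun U : 𝒰 => σ ⁻¹' U.1) isCompact_univ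
    (fun U => (hopen U.1 U.2).preimage σ.continuous) (fun x _ => by
      have : σ x ∈ ⋃₀ 𝒰 := by rw [hcov]; trivial
      obtain ⟨U, hU, hxU⟩ := this
      exact Set.mem_iUnion.2 ⟨⟨U, hU⟩, hxU⟩)
  -- Half of `δ`, because two points of `Δ` are at `ℓ¹` distance at most 2; the `ℓ¹` distance in
  -- turn dominates the maximum metric.
  obtain ⟨r, hr⟩ := exists_pow_lt_of_lt_one (half_pos hδ) hq1
  refine ⟨r, ?_⟩
  rintro _ ⟨a, rfl, ha⟩
  set x₀ := vertex n 0
  obtain ⟨U, hU⟩ := hball (a x₀) trivial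
  refine ⟨U.1, U.2, ?_⟩
  rintro _ ⟨x, rfl⟩
  refine hU ?_
  have hl1 : ∑ i, |x.1 i - x₀.1 i| ≤ 2 := by
    refine (Finset.sum_le_sum fun i _ => abs_sub (x.1 i) (x₀.1 i)).trans (le_of_eq ?_)
    rw [Finset.sum_add_distrib, Finset.sum_congr rfl fun i _ => abs_of_nonneg (x.2.1 i),
      Finset.sum_congr rfl fun i _ => abs_of_nonneg (x₀.2.1 i), x.2.2, x₀.2.2]
    norm_num
  rw [Metric.mem_ball, Subtype.dist_eq, dist_pi_lt_iff hδ]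
  intro i
  rw [Real.dist_eq]
  calc |(a x).1 i - (a x₀).1 i| ≤ ∑ i, |(a x).1 i - (a x₀).1 i| :=
        Finset.single_le_sum (f := fun i => |(a x).1 i - (a x₀).1 i|)
          (fun i _ => abs_nonneg _) (Finset.mem_univ i)
    _ ≤ q ^ r * ∑ i, |x.1 i - x₀.1 i| := ha x x₀
    _ ≤ q ^ r * 2 := mul_le_mul_of_nonneg_left hl1 (pow_nonneg hq0 r)
    _ < δ := by linarith

end Small

end PseudoBary

end

theorem mainTheorem3 {R : Type*} [CommRing R] [IsDedekindDomain R]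
    {G : Type*} [AddCommGroup G] [Module R G]
    {X : Type*} [TopologicalSpace X] [T2Space X]
    (F : PseudoBary.Filtration X) (hF : F.LocallyFinite) (p : PseudoBary.Perversity F) :
    Nonempty (PseudoBary.SimplicialSystem F) ∧
    ∀ 𝒯 : PseudoBary.SimplicialSystem F, ∃ ℬ : PseudoBary.PseudoBarycentricSystem 𝒯,
      -- `sd` is a chain map
      (∀ n, PseudoBary.boundary X R G n ∘ₗ PseudoBary.sd R G ℬ.center (n + 1) =
        PseudoBary.sd R G ℬ.center n ∘ₗ PseudoBary.boundary X R G n) ∧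
      -- `sd` preserves allowable chains
      (∀ (n : ℕ) (ξ : PseudoBary.Chain X G n), PseudoBary.AllowableChain p ξ →
        PseudoBary.AllowableChain p (PseudoBary.sd R G ℬ.center n ξ)) ∧
      -- some iterate of `sd` makes a given simplex small with respect to a given open covering
      (∀ 𝒰 : Set (Set X), (∀ U ∈ 𝒰, IsOpen U) → ⋃₀ 𝒰 = Set.univ →
        ∀ (n : ℕ) (σ : PseudoBary.Sing X n), ∃ r : ℕ, ∀ g : G,
          ∀ τ ∈ ((PseudoBary.sd R G ℬ.center n ^ r) (Finsupp.single σ g)).support,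
            ∃ U ∈ 𝒰, Set.range τ ⊆ U) ∧
      -- `sd` is homotopic to the identity through an operator that preserves allowable chains
      ∃ T : ∀ n : ℕ, PseudoBary.Chain X G n →ₗ[R] PseudoBary.Chain X G (n + 1),
        LinearMap.id - PseudoBary.sd R G ℬ.center 0 = PseudoBary.boundary X R G 0 ∘ₗ T 0 ∧
        (∀ n, LinearMap.id - PseudoBary.sd R G ℬ.center (n + 1) =
          T n ∘ₗ PseudoBary.boundary X R G n + PseudoBary.boundary X R G (n + 1) ∘ₗ T (n + 1)) ∧
        (∀ (n : ℕ) (ξ : PseudoBary.Chain X G n), PseudoBary.AllowableChain p ξ →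
          PseudoBary.AllowableChain p (T n ξ)) := by
  open PseudoBary in
  refine ⟨nonempty_simplicialSystem F, fun 𝒯 => ⟨pseudoBarycentricSystem 𝒯 hF, ?_⟩⟩
  set ℬ := pseudoBarycentricSystem 𝒯 hF
  have hbound : ∀ {n : ℕ} (σ : Sing X n) i, centerBound n ≤ (ℬ.center σ).1 i :=
    fun σ i => centerBound_le_center 𝒯 hF σ i
  refine ⟨fun n => ?_, fun n ξ hξ => ?_, fun 𝒰 hopen hcov n σ => ?_,
    fun n => modelOp R G (homotopyModel ℬ.center), ?_, fun n => ?_, fun n ξ hξ => ?_⟩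
  · rw [sd_eq_modelOp, sd_eq_modelOp, boundary_comp_modelOp, modelOp_comp_boundary]
    exact congrArg (modelOp R G) (funext fun σ => affineBoundary_sdModel ℬ.center σ)
  · exact allowableChain_modelOp R
      (fun σ => spanning_of_mem_support_sdModel ℬ.center_pos σ) hξ
  · obtain ⟨r, hr⟩ := exists_range_subset_of_lipschitz hopen hcov σ
      (sub_nonneg.2 (centerBound_le_one n)) (sub_lt_self 1 (centerBound_pos n))
    exact ⟨r, fun g τ hτ => hr τ ((Finsupp.mem_supported R _).1
      (sd_pow_mem_supported R G hbound σ r g) hτ)⟩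
  · rw [sd_eq_modelOp, ← modelOp_affineIdentity, ← modelOp_sub, boundary_comp_modelOp]
    exact congrArg (modelOp R G)
      (funext fun σ => (affineBoundary_homotopyModel_zero ℬ.center σ).symm)
  · rw [sd_eq_modelOp, ← modelOp_affineIdentity, ← modelOp_sub, boundary_comp_modelOp,
      modelOp_comp_boundary, ← modelOp_add]
    refine congrArg (modelOp R G) (funext fun σ => ?_)
    rw [affineBoundary_homotopyModel_succ, add_sub_cancel]
  · exact allowableChain_modelOp R
      (fun σ => spanning_of_mem_support_homotopyModel ℬ.center_pos σ) hξ
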